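/- **Theorem 5.2.** The *localization game* with $k$ cops on a finite connected simple graph $G$ is played as follows. The Robber secretly chooses a vertex of $G$. In each turn the Cop probes $k$ vertices $b_1,\dots,b_k$ (which may depend on all answers received so far) and receives the vector of distances $(d_G(r,b_1),\dots,d_G(r,b_k))$, where $r$ is the Robber's current vertex. If the distance vectors received up to and including this turn, together with the rules of the game, determine the Robber's current vertex $r$, then the Robber is located and the Cop wins. Otherwise the Robber either stays at $r$ or moves to a neighbour of $r$, and the next turn begins. The Cop has a winning strategy if she can ensure that the Robber is located after finitely many turns, irrespective of the Robber's moves. The *localization number* $\zeta(G)$ is the least positive integer $k$ for which the Cop has a winning strategy with $k$ cops. Let $C_m$ denote the cycle on $m$ vertices and $\square$ the Cartesian product of graphs. Let $m,n$ be integers with $m\ge n\ge 3$. If $m=n=3$, or if $m$ is even and $n=4$, then $\zeta(C_m\,\square\, C_n)=3$. Otherwise, $\zeta(C_m\,\square\, C_n)=2$. -/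

import Mathlib

namespace SimpleGraph

/-- A trajectory of the Robber: `r t` is the Robber's vertex when the probe of turn `t` is made.
The initial vertex is arbitrary; between two turns the Robber stays or moves to a neighbour. -/
def IsRobberTrajectory {V : Type*} (G : SimpleGraph V) (r : ℕ → V) : Prop :=
  ∀ t, r (t + 1) = r t ∨ G.Adj (r t) (r (t + 1))

/-- A (deterministic, adaptive) strategy for a Cop with `k` cops: the list of all distance vectors
received so far (in chronological order) determines the `k` vertices that are probed next. -/
abbrev CopStrategy (V : Type*) (k : ℕ) : Type _ :=
  List (Fin k → ℕ) → (Fin k → V)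

/-- The list of the distance vectors received in the first `t` turns (turns `0, …, t - 1`)
when the Cop follows the strategy `σ` and the Robber follows the trajectory `r`. -/
noncomputable def probeAnswers {V : Type*} (G : SimpleGraph V) {k : ℕ} (σ : CopStrategy V k)
    (r : ℕ → V) : ℕ → List (Fin k → ℕ)
  | 0 => []
  | t + 1 => probeAnswers G σ r t ++ [fun i => G.dist (r t) (σ (probeAnswers G σ r t) i)]

/-- The Cop knows the Robber's exact position after the probe of turn `t`: every possible
trajectory that produces the same distance vectors in turns `0, …, t` is at the same
vertex in turn `t`. -/
def IsLocatedAt {V : Type*} (G : SimpleGraph V) {k : ℕ} (σ : CopStrategy V k)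
    (r : ℕ → V) (t : ℕ) : Prop :=
  ∀ r' : ℕ → V, G.IsRobberTrajectory r' →
    probeAnswers G σ r' (t + 1) = probeAnswers G σ r (t + 1) → r' t = r t

/-- `k` cops suffice: some strategy locates the Robber after finitely many turns, whatever the
Robber does. -/
def CopWins {V : Type*} (G : SimpleGraph V) (k : ℕ) : Prop :=
  ∃ σ : CopStrategy V k, ∀ r : ℕ → V, G.IsRobberTrajectory r → ∃ t, G.IsLocatedAt σ r t

/-- The localization number `ζ(G)` of a connected graph: the least positive number of cops
for which the Cop has a winning strategy in the localization game. -/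
noncomputable def localizationNumber {V : Type*} (G : SimpleGraph V) : ℕ :=
  sInf {k : ℕ | 0 < k ∧ G.CopWins k}

end SimpleGraph

/-! Upper bounds follow the set of vertices where the Robber can still be (`Locatable`). The opening
probe uses antipodal (for an odd cycle, farthest) vertices of one row. If one cycle is odd and the
other has length at least 4, this reveals the column and the distance to the row, hence a reflected
pair, and one more probe separates everything near that pair. If both cycles are even of length at
least 6, it reveals only the horizontal and the vertical distance to a vertex. Of these at most four
reflected vertices and their neighbours, the second probe leaves one vertex or two diagonally
adjacent ones (`eq_or_cyclicAdjacent`), which the third probe resolves. With three cops the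
additional probe breaks the reflection symmetry directly.

Lower bounds keep a pair of distinct vertices possible after every probe (`not_copWins_of_pairs`). A
single probe takes at most three values on a closed neighbourhood, so one cop loses by pigeonhole.
For even `m` and `n = 4` the pairs are antipodal in a 4-cycle or diagonally adjacent. Along a row
the distance to a probe changes by exactly one per step, so each probe is described by three signs
and a residue modulo 4, and evasion becomes a finite check. For `m = n = 3` all pairs of distinct
vertices work, again by a finite check. -/

namespace SimpleGraph

/-! ### Information sets, evasion by pairs, and invariance under isomorphism -/

variable {V W : Type*}

/-- The closed neighbourhood of a set of vertices. -/
def closedNeighborSet (G : SimpleGraph V) (S : Set V) : Set V :=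
  {w | ∃ v ∈ S, w = v ∨ G.Adj v w}

/-- The vertices of `S` that answer the probe `p` in the same way as `v`. -/
def answerClass (G : SimpleGraph V) {k : ℕ} (p : Fin k → V) (S : Set V) (v : V) : Set V :=
  {w ∈ S | ∀ i, G.dist w (p i) = G.dist v (p i)}

/-- The Cop, knowing that the Robber is in `S`, can locate him within `t` turns. -/
def Locatable (G : SimpleGraph V) (k : ℕ) : ℕ → Set V → Prop
  | 0, _ => False
  | t + 1, S => ∃ p : Fin k → V, ∀ v ∈ S, (G.answerClass p S v).Subsingleton ∨
      Locatable G k t (G.closedNeighborSet (G.answerClass p S v))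

variable {G : SimpleGraph V} {k : ℕ}

lemma closedNeighborSet_mono {S T : Set V} (h : S ⊆ T) :
    G.closedNeighborSet S ⊆ G.closedNeighborSet T :=
  fun _ ⟨v, hv, hw⟩ => ⟨v, h hv, hw⟩

lemma Locatable.mono {t : ℕ} : ∀ {S T : Set V}, S ⊆ T → G.Locatable k t T → G.Locatable k t S := by
  induction t with
  | zero => exact fun _ h => h
  | succ t ih =>
    rintro S T hST ⟨p, hp⟩
    refine ⟨p, fun v hv => ?_⟩
    have hsub : G.answerClass p S v ⊆ G.answerClass p T v := fun w hw => ⟨hST hw.1, hw.2⟩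
    exact (hp v (hST hv)).imp (fun h => h.anti hsub) (ih (closedNeighborSet_mono hsub))

/-- The list of answers, read from the front. -/
lemma probeAnswers_succ_eq_cons (σ : CopStrategy V k) (r : ℕ → V) (t : ℕ) :
    probeAnswers G σ r (t + 1) = (fun i => G.dist (r 0) (σ [] i)) ::
      probeAnswers G (fun L => σ ((fun i => G.dist (r 0) (σ [] i)) :: L)) (fun s => r (s + 1)) t := by
  induction t with
  | zero => rfl
  | succ t ih => rw [probeAnswers, ih]; rfl

lemma IsRobberTrajectory.tail {r : ℕ → V} (h : G.IsRobberTrajectory r) :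
    G.IsRobberTrajectory fun s => r (s + 1) := fun t => h (t + 1)

lemma Locatable.exists_strategy {t : ℕ} : ∀ {S : Set V}, G.Locatable k t S →
    ∃ σ : CopStrategy V k, ∀ r : ℕ → V, G.IsRobberTrajectory r → r 0 ∈ S →
      ∃ s, ∀ r' : ℕ → V, G.IsRobberTrajectory r' → r' 0 ∈ S →
        probeAnswers G σ r' (s + 1) = probeAnswers G σ r (s + 1) → r' s = r s := by
  classical
  induction t with
  | zero => exact fun h => h.elim
  | succ t ih =>
    rintro S ⟨p, hp⟩
    have hτ : ∀ a : Fin k → ℕ, ∃ σ : CopStrategy V k,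
        G.Locatable k t (G.closedNeighborSet {w ∈ S | ∀ i, G.dist w (p i) = a i}) →
        ∀ r : ℕ → V, G.IsRobberTrajectory r →
          r 0 ∈ G.closedNeighborSet {w ∈ S | ∀ i, G.dist w (p i) = a i} →
          ∃ s, ∀ r' : ℕ → V, G.IsRobberTrajectory r' →
            r' 0 ∈ G.closedNeighborSet {w ∈ S | ∀ i, G.dist w (p i) = a i} →
            probeAnswers G σ r' (s + 1) = probeAnswers G σ r (s + 1) → r' s = r s := by
      intro a
      -- The fallback strategy is harmless: if a possible answer leaves a set that is not locatable,
      -- `hp` says that its class is a singleton, so the game is already over.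
      by_cases h : G.Locatable k t (G.closedNeighborSet {w ∈ S | ∀ i, G.dist w (p i) = a i})
      · obtain ⟨σ, hσ⟩ := ih h
        exact ⟨σ, fun _ => hσ⟩
      · exact ⟨fun _ => p, fun h' => absurd h' h⟩
    choose τ hτ using hτ
    let σ : CopStrategy V k := fun L => match L with
      | [] => p
      | a :: L' => τ a L'
    refine ⟨σ, fun r hr hrS => ?_⟩
    have hclass : ∀ r' : ℕ → V, G.IsRobberTrajectory r' → r' 0 ∈ S →
        (fun i => G.dist (r' 0) (p i)) = (fun i => G.dist (r 0) (p i)) →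
        r' 0 ∈ G.answerClass p S (r 0) := fun r' _ h h' => ⟨h, fun i => congrFun h' i⟩
    rcases hp (r 0) hrS with h | h
    · refine ⟨0, fun r' hr' hr'S he => h (hclass r' hr' hr'S ?_) (hclass r hr hrS rfl)⟩
      rw [probeAnswers_succ_eq_cons, probeAnswers_succ_eq_cons] at he
      exact (List.cons.inj he).1
    · have hnext : ∀ r' : ℕ → V, G.IsRobberTrajectory r' → r' 0 ∈ G.answerClass p S (r 0) →
          r' 1 ∈ G.closedNeighborSet (G.answerClass p S (r 0)) :=
        fun r' hr' h' => ⟨r' 0, h', hr' 0⟩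
      obtain ⟨s, hs⟩ := hτ (fun i => G.dist (r 0) (p i)) h _ hr.tail
        (hnext r hr (hclass r hr hrS rfl))
      refine ⟨s + 1, fun r' hr' hr'S he => ?_⟩
      rw [probeAnswers_succ_eq_cons, probeAnswers_succ_eq_cons σ r] at he
      obtain ⟨he₁, he₂⟩ := List.cons.inj he
      refine hs _ hr'.tail (hnext r' hr' (hclass r' hr' hr'S he₁)) ?_
      have he₁' : (fun i => G.dist (r' 0) (σ [] i)) = fun i => G.dist (r 0) (p i) := he₁
      rw [he₁'] at he₂
      exact he₂

theorem Locatable.copWins {t : ℕ} (h : G.Locatable k t Set.univ) : G.CopWins k := by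
  obtain ⟨σ, hσ⟩ := h.exists_strategy
  refine ⟨σ, fun r hr => ?_⟩
  obtain ⟨s, hs⟩ := hσ r hr trivial
  exact ⟨s, fun r' hr' he => hs r' hr' trivial he⟩

/-- A compatible choice through an inverse sequence on a two-element set. -/
lemma exists_compatible_bool (f : ℕ → Bool → Bool) : ∃ s : ℕ → Bool, ∀ t, f t (s (t + 1)) = s t := by
  classical
  -- a choice above level `t` that is compatible up to level `t + n`
  let good : ℕ → Bool → Prop := fun t i => ∀ n, ∃ c : ℕ → Bool, c t = i ∧
    ∀ m, t ≤ m → m < n → f m (c (m + 1)) = c m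
  have hback : ∀ n, ∃ c : ℕ → Bool, ∀ m, m < n → f m (c (m + 1)) = c m := by
    intro n
    -- Start with an arbitrary value at level `n` and push it down through the maps `f`.
    let c : ℕ → Bool := fun m => Nat.rec true (fun l b => f (n - 1 - l) b) (n - m)
    refine ⟨c, fun m hm => ?_⟩
    obtain ⟨d, rfl⟩ : ∃ d, n = m + 1 + d := ⟨n - (m + 1), by omega⟩
    have h1 : m + 1 + d - m = d + 1 := by omega
    have h2 : m + 1 + d - (m + 1) = d := by omega
    have h3 : m + 1 + d - 1 - d = m := by omega
    simp only [c, h1, h2, h3]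
  have hstart : ∃ i, good 0 i := by
    by_contra! h
    simp only [good, not_forall] at h
    obtain ⟨n₁, h₁⟩ := h true
    obtain ⟨n₂, h₂⟩ := h false
    obtain ⟨c, hc⟩ := hback (max n₁ n₂)
    cases hi : c 0 with
    | true => exact h₁ ⟨c, hi, fun m _ hm => hc m (by omega)⟩
    | false => exact h₂ ⟨c, hi, fun m _ hm => hc m (by omega)⟩
  have hstep : ∀ t i, good t i → ∃ j, f t j = i ∧ good (t + 1) j := by
    intro t i hi
    by_contra! h
    have hn : ∀ j, ∃ n, ∀ c : ℕ → Bool, c t = i → c (t + 1) = j →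
        ¬ ∀ m, t ≤ m → m < n → f m (c (m + 1)) = c m := by
      intro j
      by_cases hj : f t j = i
      · have := h j hj
        simp only [good, not_forall] at this
        obtain ⟨n, hn⟩ := this
        exact ⟨n, fun c _ hcj hc => hn ⟨c, hcj, fun m hm hmn => hc m (by omega) hmn⟩⟩
      · exact ⟨t + 1, fun c hct hcj hc => hj (by rw [← hcj, hc t le_rfl (by omega), hct])⟩
    obtain ⟨n₁, h₁⟩ := hn true
    obtain ⟨n₂, h₂⟩ := hn false
    obtain ⟨c, hct, hc⟩ := hi (max n₁ n₂)
    cases hj : c (t + 1) with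
    | true => exact h₁ c hct hj fun m h1 h2 => hc m h1 (by omega)
    | false => exact h₂ c hct hj fun m h1 h2 => hc m h1 (by omega)
  choose g hg using hstep
  obtain ⟨i₀, hi₀⟩ := hstart
  let s : (t : ℕ) → {i // good t i} := fun t =>
    Nat.rec ⟨i₀, hi₀⟩ (fun t x => ⟨g t x.1 x.2, (hg t x.1 x.2).2⟩) t
  exact ⟨fun t => (s t).1, fun t => (hg t (s t).1 (s t).2).1⟩

/-- The Robber evades if there is a nonempty family of pairs of vertices such that
after every probe the Cop's information is again consistent with a pair of the family. -/
theorem not_copWins_of_pairs (R : V → V → Prop) (hne : ∀ u w, R u w → u ≠ w)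
    (h₀ : ∃ u w, R u w)
    (hR : ∀ u w, R u w → ∀ p : Fin k → V, ∃ u' w', R u' w' ∧ u' ∈ G.closedNeighborSet {u, w} ∧
      w' ∈ G.closedNeighborSet {u, w} ∧ ∀ i, G.dist u' (p i) = G.dist w' (p i)) :
    ¬ G.CopWins k := by
  classical
  rintro ⟨σ, hσ⟩
  -- A state holds the past answers and a pair consistent with them. Along the sequence built below,
  -- both vertices also answer the coming probe equally, so one list records the history of both.
  let X := {q : List (Fin k → ℕ) × (Bool → V) // R (q.2 true) (q.2 false)}
  have hnext : ∀ x : X, ∃ y : X,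
      y.1.1 = x.1.1 ++ [fun i => G.dist (x.1.2 true) (σ x.1.1 i)] ∧
      (∀ b, y.1.2 b ∈ G.closedNeighborSet {x.1.2 true, x.1.2 false}) ∧
      ∀ b i, G.dist (y.1.2 b) (σ y.1.1 i) = G.dist (y.1.2 true) (σ y.1.1 i) := by
    rintro ⟨⟨L, P⟩, hP⟩
    obtain ⟨u, w, huw, hu, hw, he⟩ :=
      hR _ _ hP (σ (L ++ [fun i => G.dist (P true) (σ L i)]))
    refine ⟨⟨⟨_, fun b => cond b u w⟩, huw⟩, rfl, ?_, ?_⟩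
    · rintro (_ | _)
      exacts [hw, hu]
    · rintro (_ | _) i
      exacts [(he i).symm, rfl]
  choose nxt hn₁ hn₂ hn₃ using hnext
  obtain ⟨u, w, huw⟩ := h₀
  obtain ⟨u₀, w₀, hR₀, -, -, he₀⟩ := hR u w huw (σ [])
  let x₀ : X := ⟨⟨[], fun b => cond b u₀ w₀⟩, hR₀⟩
  let x : ℕ → X := fun t => Nat.rec x₀ (fun _ y => nxt y) t
  have hx : ∀ t, x (t + 1) = nxt (x t) := fun t => rfl
  have hans : ∀ t b i, G.dist ((x t).1.2 b) (σ (x t).1.1 i)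
      = G.dist ((x t).1.2 true) (σ (x t).1.1 i) := by
    rintro (_ | t)
    · rintro (_ | _) i
      exacts [(he₀ i).symm, rfl]
    · exact hn₃ (x t)
  have hpred : ∀ t b, ∃ b', (x (t + 1)).1.2 b = (x t).1.2 b' ∨
      G.Adj ((x t).1.2 b') ((x (t + 1)).1.2 b) := by
    intro t b
    obtain ⟨v, hv, hvw⟩ := hn₂ (x t) b
    rcases hv with rfl | rfl
    exacts [⟨true, hvw⟩, ⟨false, hvw⟩]
  choose f hf using hpred
  have hlist : ∀ (r : ℕ → V) t, (∀ j < t, ∃ b, r j = (x j).1.2 b) →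
      probeAnswers G σ r t = (x t).1.1 := by
    intro r t
    induction t with
    | zero => exact fun _ => rfl
    | succ t ih =>
      intro h
      obtain ⟨b, hb⟩ := h t (Nat.lt_succ_self t)
      rw [probeAnswers, ih fun j hj => h j (hj.trans (Nat.lt_succ_self t)), hx, hn₁, hb]
      simp only [hans t b]
  -- Every vertex of a pair has a predecessor in the previous pair but perhaps no successor in the
  -- next one, so an infinite trajectory cannot be chosen greedily; it needs this compactness
  -- argument.
  obtain ⟨s, hs⟩ := exists_compatible_bool f
  obtain ⟨t, ht⟩ := hσ (fun t => (x t).1.2 (s t)) fun t => by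
    have := hf t (s (t + 1))
    rwa [hs] at this
  -- the trajectory that ends in the other vertex of the pair
  let c : ℕ → Bool := fun j => Nat.rec (!(s t)) (fun l b => f (t - 1 - l) b) (t - j)
  have hct : c t = !(s t) := by simp [c]
  have hc : ∀ j < t, f j (c (j + 1)) = c j := by
    intro j hj
    obtain ⟨d, rfl⟩ : ∃ d, t = j + 1 + d := ⟨t - (j + 1), by omega⟩
    have h1 : j + 1 + d - j = d + 1 := by omega
    have h2 : j + 1 + d - (j + 1) = d := by omega
    have h3 : j + 1 + d - 1 - d = j := by omega
    simp only [c, h1, h2, h3]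
  let r' : ℕ → V := fun j => if j ≤ t then (x j).1.2 (c j) else (x t).1.2 (c t)
  have hr' : G.IsRobberTrajectory r' := by
    intro j
    rcases lt_trichotomy j t with h | rfl | h
    · have := hf j (c (j + 1))
      rw [hc j h] at this
      simpa only [r', if_pos h.le, if_pos (Nat.succ_le_of_lt h)] using this
    · simp [r']
    · left
      simp only [r', if_neg (show ¬ j ≤ t by omega), if_neg (show ¬ j + 1 ≤ t by omega)]
  have hend := ht r' hr' (by
    rw [hlist r' (t + 1) fun j hj => ⟨c j, by simp only [r', if_pos (Nat.lt_succ_iff.mp hj)]⟩,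
      hlist _ (t + 1) fun j _ => ⟨s j, rfl⟩])
  simp only [r', if_pos le_rfl, hct] at hend
  have hd := hne _ _ (x t).2
  cases hst : s t <;> rw [hst] at hend
  exacts [hd hend, hd hend.symm]

/-- One cop never suffices if all degrees are at least three. -/
theorem not_copWins_one_of_three_le_degree [Fintype V] [DecidableEq V] [DecidableRel G.Adj]
    [Nontrivial V] (hG : G.Connected) (hdeg : ∀ v, 3 ≤ G.degree v) : ¬ G.CopWins 1 := by
  refine not_copWins_of_pairs (fun u w => u ≠ w) (fun _ _ h => h) (exists_pair_ne V) ?_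
  intro u w _ p
  -- The distance to the probe changes by at most one on the closed neighbourhood of `u`: three
  -- values for at least four vertices.
  have hmaps : ∀ v ∈ insert u (G.neighborFinset u),
      G.dist v (p 0) ∈ Finset.Icc (G.dist u (p 0) - 1) (G.dist u (p 0) + 1) := by
    intro v hv
    rw [Finset.mem_Icc]
    rcases Finset.mem_insert.mp hv with rfl | hv
    · omega
    · rw [mem_neighborFinset] at hv
      have h1 := hG.dist_triangle (u := u) (v := v) (w := p 0)
      have h2 := hG.dist_triangle (u := v) (v := u) (w := p 0)
      rw [G.dist_comm (u := v) (v := u)] at h2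
      rw [dist_eq_one_iff_adj.mpr hv] at h1 h2
      omega
  obtain ⟨a, ha, b, hb, hab, he⟩ := Finset.exists_ne_map_eq_of_card_lt_of_maps_to
    (t := Finset.Icc (G.dist u (p 0) - 1) (G.dist u (p 0) + 1)) (by
      rw [Finset.card_insert_of_notMem (by simp), card_neighborFinset_eq_degree, Nat.card_Icc]
      have := hdeg u
      omega) hmaps
  have hmem : ∀ v ∈ insert u (G.neighborFinset u), v ∈ G.closedNeighborSet {u, w} := by
    intro v hv
    refine ⟨u, by simp, ?_⟩
    simpa using hv
  exact ⟨a, b, hab, hmem a ha, hmem b hb, fun i => by rw [Subsingleton.elim i 0]; exact he⟩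

lemma Iso.dist_apply {H : SimpleGraph W} (φ : G ≃g H) (u v : V) :
    H.dist (φ u) (φ v) = G.dist u v := by
  rw [dist_eq_sInf, dist_eq_sInf]
  congr 1
  ext l
  constructor
  · rintro ⟨p, rfl⟩
    exact ⟨(p.map φ.symm.toHom).copy (φ.symm_apply_apply u) (φ.symm_apply_apply v), by simp⟩
  · rintro ⟨p, rfl⟩
    exact ⟨p.map φ.toHom, by simp⟩

lemma CopWins.of_iso {H : SimpleGraph W} (φ : G ≃g H) (h : G.CopWins k) : H.CopWins k := by
  obtain ⟨σ, hσ⟩ := h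
  have hans : ∀ (r : ℕ → W) t, probeAnswers H (fun L i => φ (σ L i)) r t =
      probeAnswers G σ (fun s => φ.symm (r s)) t := by
    intro r t
    induction t with
    | zero => rfl
    | succ t ih =>
      simp only [probeAnswers, ih]
      congr 3
      funext i
      rw [← Iso.dist_apply φ, RelIso.apply_symm_apply]
  have htraj : ∀ r : ℕ → W, H.IsRobberTrajectory r →
      G.IsRobberTrajectory fun s => φ.symm (r s) := by
    intro r hr t
    exact (hr t).imp (congrArg φ.symm) φ.symm.map_adj_iff.mpr
  refine ⟨fun L i => φ (σ L i), fun r hr => ?_⟩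
  obtain ⟨t, ht⟩ := hσ _ (htraj r hr)
  refine ⟨t, fun r' hr' he => φ.symm.injective (ht _ (htraj r' hr') ?_)⟩
  rw [← hans, ← hans, he]

end SimpleGraph

/-! ### Distances in cycles and toroidal grids, in integer coordinates -/

namespace SimpleGraph

/-- The residue of an integer as a vertex of the cycle on `m` vertices. -/
def cycleVertex (m : ℕ) [NeZero m] (x : ℤ) : Fin m :=
  ⟨(x % m).toNat, by
    have hm : (0 : ℤ) < m := by exact_mod_cast Nat.pos_of_ne_zero (NeZero.ne m)
    have := Int.emod_lt_of_pos x hm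
    have := Int.emod_nonneg x hm.ne'
    omega⟩

/-- The length of a shortest arc of the cycle on `m` vertices between vertices with difference `z`. -/
def arcLength (m : ℕ) (z : ℤ) : ℕ := (min (z % m) (-z % m)).toNat

lemma arcLength_neg (m : ℕ) (z : ℤ) : arcLength m (-z) = arcLength m z := by
  rw [arcLength, arcLength, neg_neg, min_comm]

lemma arcLength_eq_natAbs {m : ℕ} {z : ℤ} (h : 2 * z.natAbs ≤ m) : arcLength m z = z.natAbs := by
  rcases Nat.eq_zero_or_pos m with rfl | hm
  · obtain rfl : z = 0 := by omega
    rfl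
  wlog hz : 0 ≤ z generalizing z
  · rw [← arcLength_neg, this (by omega) (by omega), Int.natAbs_neg]
  rw [arcLength, Int.emod_eq_of_lt hz (by omega)]
  rcases hz.eq_or_lt with rfl | hz
  · simp
  · rw [← Int.add_emod_right, Int.emod_eq_of_lt (by omega) (by omega)]
    omega

lemma arcLength_sub_mul (m : ℕ) (z c : ℤ) : arcLength m (z - m * c) = arcLength m z := by
  rw [arcLength, arcLength, Int.sub_mul_emod_self_left, neg_sub, sub_eq_add_neg, add_comm,
    Int.add_mul_emod_self_left]

/-- The value of the arc length for differences of at most three half-turns. -/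
lemma arcLength_eq_min {m : ℕ} {z : ℤ} (h : 2 * z.natAbs ≤ 3 * m) :
    arcLength m z = min z.natAbs ((z.natAbs - m) + (m - z.natAbs)) := by
  by_cases h₁ : 2 * z.natAbs ≤ m
  · rw [arcLength_eq_natAbs h₁]; omega
  · rcases le_total 0 z with hz | hz
    · rw [← arcLength_sub_mul m z 1, arcLength_eq_natAbs (by omega)]; omega
    · rw [← arcLength_sub_mul m z (-1), arcLength_eq_natAbs (by omega)]; omega

lemma arcLength_of_nonneg {n : ℕ} {z : ℤ} (h₀ : 0 ≤ z) (h : 2 * z ≤ n) : (arcLength n z : ℤ) = z := by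
  rw [arcLength_eq_natAbs (by omega)]; omega

lemma arcLength_of_nonpos {n : ℕ} {z : ℤ} (h₀ : z ≤ 0) (h : -(2 * z) ≤ n) : (arcLength n z : ℤ) = -z := by
  rw [arcLength_eq_natAbs (by omega)]; omega

lemma arcLength_of_le_two_mul {n : ℕ} {z : ℤ} (h₀ : n ≤ 2 * z) (h : z ≤ n) :
    (arcLength n z : ℤ) = n - z := by
  rw [← arcLength_sub_mul n z 1, arcLength_of_nonpos (by omega) (by omega)]; omega

lemma arcLength_of_le {n : ℕ} {z : ℤ} (h₀ : n ≤ z) (h : 2 * z ≤ 3 * n) : (arcLength n z : ℤ) = z - n := by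
  rw [← arcLength_sub_mul n z 1, arcLength_of_nonneg (by omega) (by omega)]; omega

variable {m n : ℕ} [NeZero m] [NeZero n]

lemma emod_le_of_nonneg_of_pos {z k : ℤ} (hz : 0 ≤ z) (hk : 0 < k) : z % k ≤ z := by
  have h₁ := Int.emod_add_mul_ediv z k
  have h₂ : 0 ≤ k * (z / k) := mul_nonneg hk.le (Int.ediv_nonneg hz hk.le)
  omega

lemma arcLength_le_natAbs (m : ℕ) [NeZero m] (z : ℤ) : arcLength m z ≤ z.natAbs := by
  have hm : (0 : ℤ) < m := by exact_mod_cast Nat.pos_of_ne_zero (NeZero.ne m)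
  rw [arcLength]
  rcases le_total 0 z with hz | hz
  · have := emod_le_of_nonneg_of_pos hz hm
    omega
  · have := emod_le_of_nonneg_of_pos (z := -z) (by omega) hm
    omega

lemma cycleVertex_eq_iff {x y : ℤ} : cycleVertex m x = cycleVertex m y ↔ (m : ℤ) ∣ x - y := by
  have hm : (0 : ℤ) < m := by exact_mod_cast Nat.pos_of_ne_zero (NeZero.ne m)
  have h1 := Int.emod_nonneg x hm.ne'
  have h2 := Int.emod_nonneg y hm.ne'
  rw [cycleVertex, cycleVertex, Fin.mk.injEq, Int.dvd_iff_emod_eq_zero,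
    ← Int.emod_eq_emod_iff_emod_sub_eq_zero]
  omega

lemma exists_cycleVertex_eq (c : ℤ) (v : Fin m) : ∃ x, c ≤ x ∧ x < c + m ∧ v = cycleVertex m x := by
  have hm : (0 : ℤ) < m := by exact_mod_cast Nat.pos_of_ne_zero (NeZero.ne m)
  have h1 := Int.emod_nonneg ((v : ℤ) - c) hm.ne'
  have h2 := Int.emod_lt_of_pos ((v : ℤ) - c) hm
  refine ⟨c + ((v : ℤ) - c) % m, by omega, by omega, ?_⟩
  have hv : v = cycleVertex m (v : ℤ) := by
    have := v.isLt
    ext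
    simp only [cycleVertex, Int.emod_eq_of_lt (Int.natCast_nonneg v) (Int.ofNat_lt.mpr this),
      Int.toNat_natCast]
  conv_lhs => rw [hv]
  rw [cycleVertex_eq_iff]
  have := Int.emod_add_mul_ediv ((v : ℤ) - c) m
  exact ⟨((v : ℤ) - c) / m, by omega⟩

lemma cycleVertex_val_sub (x y : ℤ) :
    (((cycleVertex m x - cycleVertex m y : Fin m) : ℕ) : ℤ) = (x - y) % m := by
  have hm : (0 : ℤ) < m := by exact_mod_cast Nat.pos_of_ne_zero (NeZero.ne m)
  have h1 := Int.emod_nonneg x hm.ne'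
  have h2 := Int.emod_nonneg y hm.ne'
  have h3 := Int.emod_lt_of_pos y hm
  have h : ((m - (y % m).toNat + (x % m).toNat : ℕ) : ℤ) = x % m - y % m + m := by omega
  simp only [Fin.sub_def, cycleVertex, Int.natCast_emod, h, Int.add_emod_right, ← Int.sub_emod]

lemma cycleGraph_adj_cycleVertex (hm : 3 ≤ m) {x : ℤ} {w : Fin m} :
    (cycleGraph m).Adj (cycleVertex m x) w ↔
      w = cycleVertex m (x + 1) ∨ w = cycleVertex m (x - 1) := by
  obtain ⟨y, -, -, rfl⟩ := exists_cycleVertex_eq 0 w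
  have hone : ∀ z : ℤ, z % m = 1 ↔ (m : ℤ) ∣ z - 1 := fun z => by
    rw [Int.dvd_iff_emod_eq_zero, ← Int.emod_eq_emod_iff_emod_sub_eq_zero,
      Int.emod_eq_of_lt (a := 1) (by omega) (by omega)]
  rw [cycleGraph_adj', ← Nat.cast_inj (R := ℤ), ← Nat.cast_inj (R := ℤ), cycleVertex_val_sub,
    cycleVertex_val_sub, Nat.cast_one, hone, hone, cycleVertex_eq_iff, cycleVertex_eq_iff, or_comm]
  refine or_congr (by rw [sub_sub]) ?_
  rw [← dvd_neg]
  ring_nf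

lemma cycleGraph_connected_of_neZero : (cycleGraph m).Connected := by
  obtain ⟨l, rfl⟩ := Nat.exists_eq_succ_of_ne_zero (NeZero.ne m)
  exact cycleGraph_connected

lemma cycleGraph_dist_cycleVertex (hm : 3 ≤ m) (x y : ℤ) :
    (cycleGraph m).dist (cycleVertex m x) (cycleVertex m y) = arcLength m (x - y) := by
  have hm' : (0 : ℤ) < m := by omega
  have hup : ∀ (l : ℕ) (x : ℤ),
      (cycleGraph m).dist (cycleVertex m x) (cycleVertex m (x + l)) ≤ l := by
    intro l
    induction l with
    | zero => simp
    | succ l ih =>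
      intro x
      refine (cycleGraph_connected_of_neZero.dist_triangle (v := cycleVertex m (x + l))).trans ?_
      have hadj : (cycleGraph m).Adj (cycleVertex m (x + l)) (cycleVertex m (x + (l + 1 : ℕ))) :=
        (cycleGraph_adj_cycleVertex hm).mpr (Or.inl (by push_cast; ring_nf))
      rw [dist_eq_one_iff_adj.mpr hadj]
      exact Nat.add_le_add_right (ih x) 1
  have hmod : ∀ x y : ℤ, (cycleGraph m).dist (cycleVertex m x) (cycleVertex m y) ≤
      ((y - x) % m).toNat := by
    intro x y
    have h := hup ((y - x) % m).toNat x
    have he : cycleVertex m (x + (y - x) % m) = cycleVertex m y := by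
      have := Int.emod_add_mul_ediv (y - x) m
      exact cycleVertex_eq_iff.mpr ⟨-((y - x) / m), by rw [mul_neg]; omega⟩
    rwa [Int.toNat_of_nonneg (Int.emod_nonneg _ hm'.ne'), he] at h
  apply le_antisymm
  · have h₁ := hmod x y
    have h₂ := hmod y x
    rw [dist_comm] at h₂
    rw [arcLength, neg_sub]
    omega
  · obtain ⟨p, hp⟩ := cycleGraph_connected_of_neZero.exists_walk_length_eq_dist
      (cycleVertex m x) (cycleVertex m y)
    rw [← hp]
    -- Lift a walk to the integers: its endpoint gets a representative whose displacement is at most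
    -- the length.
    have hwalk : ∀ {u v : Fin m} (p : (cycleGraph m).Walk u v) (x : ℤ), u = cycleVertex m x →
        ∃ z, v = cycleVertex m z ∧ (x - z).natAbs ≤ p.length := by
      intro u v p
      induction p with
      | nil => exact fun x hx => ⟨x, hx, by simp⟩
      | cons h p ih =>
        rintro x rfl
        rcases (cycleGraph_adj_cycleVertex hm).mp h with h | h
        · obtain ⟨z, hz, hl⟩ := ih _ h
          exact ⟨z, hz, by rw [Walk.length_cons]; omega⟩
        · obtain ⟨z, hz, hl⟩ := ih _ h
          exact ⟨z, hz, by rw [Walk.length_cons]; omega⟩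
    obtain ⟨z, hz, hl⟩ := hwalk p x rfl
    obtain ⟨c, hc⟩ := cycleVertex_eq_iff.mp hz
    have : x - y = x - z - m * c := by omega
    rw [this, arcLength_sub_mul]
    exact (arcLength_le_natAbs m _).trans hl

/-- The toroidal grid. -/
abbrev torus (m n : ℕ) : SimpleGraph (Fin m × Fin n) := boxProd (cycleGraph m) (cycleGraph n)

/-- The vertex of the toroidal grid with given integral coordinates. -/
def torusVertex (m n : ℕ) [NeZero m] [NeZero n] (x y : ℤ) : Fin m × Fin n :=
  (cycleVertex m x, cycleVertex n y)

lemma torus_connected : (torus m n).Connected :=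
  cycleGraph_connected_of_neZero.boxProd cycleGraph_connected_of_neZero

lemma torus_dist (hm : 3 ≤ m) (hn : 3 ≤ n) (x y a b : ℤ) :
    (torus m n).dist (torusVertex m n x y) (torusVertex m n a b) =
      arcLength m (x - a) + arcLength n (y - b) := by
  rw [← Nat.cast_inj (R := ℕ∞), (torus_connected _ _).coe_dist_eq_edist, edist_boxProd,
    ← (cycleGraph_connected_of_neZero _ _).coe_dist_eq_edist,
    ← (cycleGraph_connected_of_neZero _ _).coe_dist_eq_edist, torusVertex, torusVertex,
    cycleGraph_dist_cycleVertex hm, cycleGraph_dist_cycleVertex hn, Nat.cast_add]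

lemma torusVertex_eq_iff {x y x' y' : ℤ} : torusVertex m n x y = torusVertex m n x' y' ↔
    (m : ℤ) ∣ x - x' ∧ (n : ℤ) ∣ y - y' := by
  rw [torusVertex, torusVertex, Prod.mk.injEq, cycleVertex_eq_iff, cycleVertex_eq_iff]

lemma exists_torusVertex_eq (a b : ℤ) (v : Fin m × Fin n) :
    ∃ x y, a ≤ x ∧ x < a + m ∧ b ≤ y ∧ y < b + n ∧ v = torusVertex m n x y := by
  obtain ⟨x, hx₁, hx₂, hx⟩ := exists_cycleVertex_eq a v.1
  obtain ⟨y, hy₁, hy₂, hy⟩ := exists_cycleVertex_eq b v.2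
  exact ⟨x, y, hx₁, hx₂, hy₁, hy₂, Prod.ext hx hy⟩

lemma torus_eq_or_adj_iff (hm : 3 ≤ m) (hn : 3 ≤ n) {x y : ℤ} {w : Fin m × Fin n} :
    (w = torusVertex m n x y ∨ (torus m n).Adj (torusVertex m n x y) w) ↔
      ∃ dx dy : ℤ, dx.natAbs + dy.natAbs ≤ 1 ∧ w = torusVertex m n (x + dx) (y + dy) := by
  constructor
  · rintro (rfl | h)
    · exact ⟨0, 0, by simp, by simp⟩
    · rcases boxProd_adj.mp h with ⟨h, he⟩ | ⟨h, he⟩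
      · rcases (cycleGraph_adj_cycleVertex hm).mp h with h | h
        · exact ⟨1, 0, by simp, Prod.ext h (by simpa [torusVertex] using he.symm)⟩
        · exact ⟨-1, 0, by simp, Prod.ext h (by simpa [torusVertex] using he.symm)⟩
      · rcases (cycleGraph_adj_cycleVertex hn).mp h with h | h
        · exact ⟨0, 1, by simp, Prod.ext (by simpa [torusVertex] using he.symm) h⟩
        · exact ⟨0, -1, by simp, Prod.ext (by simpa [torusVertex] using he.symm) h⟩
  · rintro ⟨dx, dy, hd, rfl⟩
    obtain ⟨rfl, rfl⟩ | ⟨rfl | rfl, rfl⟩ | ⟨rfl, rfl | rfl⟩ : (dx = 0 ∧ dy = 0) ∨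
        ((dx = 1 ∨ dx = -1) ∧ dy = 0) ∨ (dx = 0 ∧ (dy = 1 ∨ dy = -1)) := by omega
    · simp
    · exact Or.inr (boxProd_adj.mpr (Or.inl
        ⟨(cycleGraph_adj_cycleVertex hm).mpr (Or.inl rfl), by simp [torusVertex]⟩))
    · exact Or.inr (boxProd_adj.mpr (Or.inl
        ⟨(cycleGraph_adj_cycleVertex hm).mpr (Or.inr rfl), by simp [torusVertex]⟩))
    · exact Or.inr (boxProd_adj.mpr (Or.inr
        ⟨(cycleGraph_adj_cycleVertex hn).mpr (Or.inl rfl), by simp [torusVertex]⟩))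
    · exact Or.inr (boxProd_adj.mpr (Or.inr
        ⟨(cycleGraph_adj_cycleVertex hn).mpr (Or.inr rfl), by simp [torusVertex]⟩))

theorem not_copWins_one_torus (hm : 3 ≤ m) (hn : 3 ≤ n) : ¬ (torus m n).CopWins 1 := by
  obtain ⟨a, rfl⟩ := Nat.exists_eq_add_of_le' hm
  obtain ⟨b, rfl⟩ := Nat.exists_eq_add_of_le' hn
  classical
  refine not_copWins_one_of_three_le_degree torus_connected fun v => ?_
  rw [degree_boxProd, cycleGraph_degree_three_le, cycleGraph_degree_three_le]
  norm_num

end SimpleGraph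

/-! ### Two cops when one cycle is odd -/

namespace SimpleGraph

lemma answerClass_subsingleton {V : Type*} {G : SimpleGraph V} {k : ℕ} {p : Fin k → V} {S : Set V}
    (h : ∀ a ∈ S, ∀ b ∈ S, (∀ i, G.dist a (p i) = G.dist b (p i)) → a = b) (v : V) :
    (G.answerClass p S v).Subsingleton :=
  fun a ha b hb => h a ha.1 b hb.1 fun i => (ha.2 i).trans (hb.2 i).symm

/-- The distances from the vertices near `c` and `-c` to two adjacent probes on a cycle. -/
lemma arcLength_reflected_cases {n : ℕ} (hn : 4 ≤ n) {k c y dy : ℤ} (hk : k = n / 2) (hc : 0 ≤ c) (hcn : 2 * c ≤ n)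
    (hy : y = c ∨ y = -c) (hd : -1 ≤ dy) (hd' : dy ≤ 1) :
    ∃ f g : ℤ, arcLength n (y + dy - (k - c - 2)) = f ∧ arcLength n (y + dy - (k - c - 1)) = g ∧
      ((y = -c ∧ f = k - 2 - dy ∧ g = k - 1 - dy ∧ 0 ≤ f) ∨
      (y = -c ∧ k = 2 ∧ dy = 1 ∧ f = 1 ∧ g = 0) ∨
      (y = c ∧ 2 * c + dy + 1 - k < 0 ∧ g = -(2 * c + dy + 1 - k) ∧ f = g - 1) ∨
      (y = c ∧ 0 ≤ 2 * c + dy + 1 - k ∧ 2 * c + dy + 1 - k < k ∧ g = 2 * c + dy + 1 - k ∧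
        f = g + 1) ∨
      (y = c ∧ 2 * c + dy + 1 - k = k ∧ n = 2 * k + 1 ∧ g = k ∧ f = k) ∨
      (y = c ∧ n ≤ 2 * (2 * c + dy + 1 - k) ∧ 2 * c + dy + 1 - k < n ∧
        g = n - (2 * c + dy + 1 - k) ∧ f = g - 1) ∨
      (y = c ∧ n = 4 ∧ c = 2 ∧ dy = 1 ∧ g = 0 ∧ f = 1)) := by
  refine ⟨_, _, rfl, rfl, ?_⟩
  rcases hy with rfl | rfl
  · obtain ⟨q, hq⟩ : ∃ q, q = 2 * y + dy + 1 - k := ⟨_, rfl⟩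
    rw [show y + dy - (k - y - 2) = q + 1 by omega, show y + dy - (k - y - 1) = q by omega, ← hq]
    right; right
    rcases lt_or_ge q 0 with h | h
    · rw [arcLength_of_nonpos (z := q) (by omega) (by omega),
        arcLength_of_nonpos (z := q + 1) (by omega) (by omega)]
      exact Or.inl ⟨rfl, h, rfl, by omega⟩
    right
    rcases lt_or_ge q k with h' | h'
    · rw [arcLength_of_nonneg (z := q) (by omega) (by omega),
        arcLength_of_nonneg (z := q + 1) (by omega) (by omega)]
      exact Or.inl ⟨rfl, h, h', rfl, rfl⟩
    right
    rcases lt_or_ge (2 * q) n with h'' | h''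
    · rw [arcLength_of_nonneg (z := q) (by omega) (by omega),
        arcLength_of_le_two_mul (z := q + 1) (by omega) (by omega)]
      exact Or.inl ⟨rfl, by omega, by omega, by omega, by omega⟩
    right
    rcases lt_or_ge q n with h3 | h3
    · rw [arcLength_of_le_two_mul (z := q) (by omega) (by omega),
        arcLength_of_le_two_mul (z := q + 1) (by omega) (by omega)]
      exact Or.inl ⟨rfl, h'', h3, rfl, by omega⟩
    · rw [arcLength_of_le (z := q) (by omega) (by omega),
        arcLength_of_le (z := q + 1) (by omega) (by omega)]
      exact Or.inr ⟨rfl, by omega, by omega, by omega, by omega, by omega⟩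
  · rw [show -c + dy - (k - c - 2) = dy - k + 2 by ring,
      show -c + dy - (k - c - 1) = dy - k + 1 by ring,
      arcLength_of_nonpos (z := dy - k + 1) (by omega) (by omega)]
    rcases le_or_gt (dy - k + 2) 0 with h | h
    · rw [arcLength_of_nonpos (z := dy - k + 2) (by omega) (by omega)]
      exact Or.inl ⟨rfl, by omega, by omega, by omega⟩
    · rw [arcLength_of_nonneg (z := dy - k + 2) (by omega) (by omega)]
      exact Or.inr (Or.inl ⟨rfl, by omega, by omega, by omega, by omega⟩)

/-- The probes of `arcLength_reflected_cases` remain distinguishing when the answers may each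
be lowered by one because of a horizontal move. -/
lemma eq_of_arcLength_reflected {n : ℕ} (hn : 4 ≤ n) {k c y dy y' dy' u v u' v' : ℤ} (hk : k = n / 2)
    (hc : 0 ≤ c) (hcn : 2 * c ≤ n)
    (hy : y = c ∨ y = -c) (hy' : y' = c ∨ y' = -c) (hu : 0 ≤ u) (hv : 0 ≤ v) (hu' : 0 ≤ u')
    (hv' : 0 ≤ v') (h1 : u + v + dy ≤ 1) (h2 : u + v - dy ≤ 1) (h1' : u' + v' + dy' ≤ 1)
    (h2' : u' + v' - dy' ≤ 1)
    (e1 : (arcLength n (y + dy - (k - c - 2)) : ℤ) - u = arcLength n (y' + dy' - (k - c - 2)) - u')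
    (e2 : (arcLength n (y + dy - (k - c - 1)) : ℤ) - v = arcLength n (y' + dy' - (k - c - 1)) - v') :
    u = u' ∧ v = v' ∧ (y + dy - (y' + dy') = 0 ∨ y + dy - (y' + dy') = n ∨
      y + dy - (y' + dy') = -n) := by
  obtain ⟨f, g, hf, hg, H⟩ := arcLength_reflected_cases hn hk hc hcn hy (dy := dy) (by omega) (by omega)
  obtain ⟨f', g', hf', hg', H'⟩ := arcLength_reflected_cases hn hk hc hcn hy' (dy := dy') (by omega) (by omega)
  rw [hf, hf'] at e1
  rw [hg, hg'] at e2
  clear hf hg hf' hg' hy hy'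
  -- If `u = u'` and `v = v'`, both rows have the same distances to two adjacent vertices of the
  -- cycle, so they agree modulo `n`. Otherwise horizontal moves must compensate for different
  -- values of `f - g`. A horizontal move excludes a vertical one, which leaves conditions such as
  -- `2 * c + 1 - k = k - 2`, impossible by parity.
  rcases H with H | H | H | H | H | H | H <;>
    rcases H' with H' | H' | H' | H' | H' | H' | H' <;> omega
variable {m n : ℕ} [NeZero m] [NeZero n]

lemma mem_closedNeighborSet_pair (hm : 3 ≤ m) (hn : 3 ≤ n) {x y x' y' : ℤ}
    {w : Fin m × Fin n} :
    w ∈ (torus m n).closedNeighborSet {torusVertex m n x y, torusVertex m n x' y'} ↔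
      ∃ dx dy : ℤ, dx.natAbs + dy.natAbs ≤ 1 ∧ (w = torusVertex m n (x + dx) (y + dy) ∨
        w = torusVertex m n (x' + dx) (y' + dy)) := by
  constructor
  · rintro ⟨v, rfl | rfl, hw⟩
    · obtain ⟨dx, dy, hd, h⟩ := (torus_eq_or_adj_iff hm hn).mp hw
      exact ⟨dx, dy, hd, Or.inl h⟩
    · obtain ⟨dx, dy, hd, h⟩ := (torus_eq_or_adj_iff hm hn).mp hw
      exact ⟨dx, dy, hd, Or.inr h⟩
  · rintro ⟨dx, dy, hd, h | h⟩
    · exact ⟨_, by simp, (torus_eq_or_adj_iff hm hn).mpr ⟨dx, dy, hd, h⟩⟩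
    · exact ⟨_, by simp, (torus_eq_or_adj_iff hm hn).mpr ⟨dx, dy, hd, h⟩⟩

/-- Antipodal probes on an odd cycle distinguish all vertices near a reflected pair. -/
lemma locatable_reflected_pair_of_odd {h : ℕ} (hm : m = 2 * h + 1) (hh : 1 ≤ h) (hn : 4 ≤ n)
    (x : ℤ) {c : ℤ} (hc : 0 ≤ c) (hcn : 2 * c ≤ n) :
    (torus m n).Locatable 2 1
      ((torus m n).closedNeighborSet {torusVertex m n x c, torusVertex m n x (-c)}) := by
  have hm3 : 3 ≤ m := by omega
  have hn3 : 3 ≤ n := by omega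
  obtain ⟨k, hk⟩ : ∃ k : ℤ, k = n / 2 := ⟨_, rfl⟩
  refine ⟨![torusVertex m n (x + h) (k - c - 2), torusVertex m n (x - h) (k - c - 1)],
    fun v _ => Or.inl (answerClass_subsingleton ?_ v)⟩
  intro a ha b hb hab
  have hrep : ∀ w ∈ (torus m n).closedNeighborSet {torusVertex m n x c, torusVertex m n x (-c)},
      ∃ dx y dy : ℤ, (y = c ∨ y = -c) ∧ dx.natAbs + dy.natAbs ≤ 1 ∧
        w = torusVertex m n (x + dx) (y + dy) := by
    intro w hw
    obtain ⟨dx, dy, hd, h | h⟩ := (mem_closedNeighborSet_pair hm3 hn3).mp hw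
    · exact ⟨dx, c, dy, Or.inl rfl, hd, h⟩
    · exact ⟨dx, -c, dy, Or.inr rfl, hd, h⟩
  obtain ⟨dx, y, dy, hy, hd, rfl⟩ := hrep a ha
  obtain ⟨dx', y', dy', hy', hd', rfl⟩ := hrep b hb
  have h0 := hab 0
  have h1 := hab 1
  simp only [Matrix.cons_val_zero, Matrix.cons_val_one, torus_dist hm3 hn3] at h0 h1
  have ha0 : ∀ d : ℤ, d.natAbs ≤ 1 → (arcLength m (x + d - (x + h)) : ℤ) = h - max d 0 := by
    intro d hd
    rw [show x + d - (x + h) = d - h by ring, arcLength_eq_min (by omega)]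
    omega
  have ha1 : ∀ d : ℤ, d.natAbs ≤ 1 → (arcLength m (x + d - (x - h)) : ℤ) = h - max (-d) 0 := by
    intro d hd
    rw [show x + d - (x - h) = d + h by ring, arcLength_eq_min (by omega)]
    omega
  have e0 := ha0 dx (by omega)
  have e0' := ha0 dx' (by omega)
  have e1 := ha1 dx (by omega)
  have e1' := ha1 dx' (by omega)
  have key := eq_of_arcLength_reflected (u := max dx 0) (v := max (-dx) 0) (u' := max dx' 0)
    (v' := max (-dx') 0) (dy := dy) (dy' := dy') hn hk hc hcn hy hy' (by omega) (by omega)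
    (by omega) (by omega) (by omega) (by omega) (by omega) (by omega) (by omega) (by omega)
  obtain ⟨k₁, k₂, k₃⟩ := key
  obtain rfl : dx = dx' := by omega
  rw [torusVertex_eq_iff]
  refine ⟨by simp, ?_⟩
  rcases k₃ with h | h | h <;> simp [h]

/-- On an odd cycle, two cops on antipodal vertices of a row find the column of the Robber and
the distance to the row. -/
theorem copWins_two_torus_of_odd (hm : Odd m) (hm3 : 3 ≤ m) (hn : 4 ≤ n) :
    (torus m n).CopWins 2 := by
  obtain ⟨h, hh⟩ := hm
  have hn3 : 3 ≤ n := by omega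
  refine Locatable.copWins (t := 2) ⟨![torusVertex m n 0 0, torusVertex m n h 0],
    fun v _ => Or.inr ?_⟩
  obtain ⟨x, y, hx₁, hx₂, hy₁, hy₂, rfl⟩ := exists_torusVertex_eq (-(h : ℤ)) (-(n / 2 : ℤ)) v
  have hsub : (torus m n).answerClass ![torusVertex m n 0 0, torusVertex m n h 0] Set.univ
      (torusVertex m n x y) ⊆ {torusVertex m n x |y|, torusVertex m n x (-|y|)} := by
    rintro w ⟨-, hw⟩
    obtain ⟨x', y', hx₁', hx₂', hy₁', hy₂', rfl⟩ :=
      exists_torusVertex_eq (-(h : ℤ)) (-(n / 2 : ℤ)) w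
    have h0 := hw 0
    have h1 := hw 1
    simp only [Matrix.cons_val_zero, Matrix.cons_val_one, torus_dist hm3 hn3, sub_zero] at h0 h1
    rw [arcLength_eq_natAbs (m := m) (z := x) (by omega),
      arcLength_eq_natAbs (m := m) (z := x') (by omega),
      arcLength_eq_natAbs (m := n) (z := y) (by omega),
      arcLength_eq_natAbs (m := n) (z := y') (by omega)] at h0
    rw [arcLength_eq_min (m := m) (z := x - h) (by omega),
      arcLength_eq_min (m := m) (z := x' - h) (by omega),
      arcLength_eq_natAbs (m := n) (z := y) (by omega),
      arcLength_eq_natAbs (m := n) (z := y') (by omega)] at h1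
    -- The two horizontal distances add up to `h` if `0 ≤ x` and to `h + 1` if `x < 0`, so the
    -- parity of the sum of the answers reveals the side. Then the sum gives `|y|`, and the first
    -- answer gives `x`.
    have hxx : x' = x := by omega
    subst hxx
    have : y' = |y| ∨ y' = -|y| := by
      rcases abs_cases y with ⟨h, -⟩ | ⟨h, -⟩ <;> rw [h] <;> omega
    rcases this with h | h <;> simp [h]
  exact (locatable_reflected_pair_of_odd hh (by omega) hn x (abs_nonneg y)
    (by rcases abs_cases y with ⟨h, -⟩ | ⟨h, -⟩ <;> rw [h] <;> omega)).mono
    (closedNeighborSet_mono hsub)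

end SimpleGraph

/-! ### Two cops when both cycles are even of length at least 6 -/

namespace SimpleGraph

lemma exists_eq_add_mul_of_even {h : ℕ} (hh : 1 ≤ h) (z : ℤ) :
    ∃ r c : ℤ, z = r + (2 * h : ℕ) * c ∧ -h < r ∧ r ≤ h := by
  have h₁ := Int.emod_add_mul_ediv (z + h - 1) (2 * h : ℕ)
  have h₂ := Int.emod_nonneg (z + h - 1) (b := (2 * h : ℕ)) (by omega)
  have h₃ := Int.emod_lt_of_pos (z + h - 1) (b := (2 * h : ℕ)) (by omega)
  exact ⟨(z + h - 1) % (2 * h : ℕ) - h + 1, (z + h - 1) / (2 * h : ℕ), by omega, by omega, by omega⟩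

/-- Because of this, probes at antipodal vertices of one row separate the horizontal from the
vertical distance: take the sum and the difference of the answers. -/
lemma arcLength_two_mul_sub_half {h : ℕ} (hh : 1 ≤ h) (z : ℤ) :
    (arcLength (2 * h) (z - h) : ℤ) = h - arcLength (2 * h) z := by
  obtain ⟨r, c, rfl, h₁, h₂⟩ := exists_eq_add_mul_of_even hh z
  rw [← arcLength_sub_mul _ _ c, ← arcLength_sub_mul _ (r + _) c,
    show r + (2 * h : ℕ) * c - h - (2 * h : ℕ) * c = r - h by ring, add_sub_cancel_right]
  rcases le_total 0 r with hr | hr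
  · rw [arcLength_of_nonneg hr (by omega), arcLength_of_nonpos (by omega) (by omega)]; omega
  · rw [arcLength_of_nonpos hr (by omega), ← arcLength_sub_mul _ _ (-1),
      arcLength_of_nonneg (by omega) (by omega)]
    omega

lemma arcLength_two_mul_add_one {h : ℕ} (hh : 1 ≤ h) {z : ℤ} (h₁ : -h ≤ z) (h₂ : z ≤ h) :
    (0 ≤ z ∧ z < h ∧ (arcLength (2 * h) (z + 1) : ℤ) = z + 1) ∨
      (z < 0 ∧ (arcLength (2 * h) (z + 1) : ℤ) = -z - 1) ∨
      (z = h ∧ (arcLength (2 * h) (z + 1) : ℤ) = h - 1) := by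
  rcases lt_trichotomy z h with h | h | h
  · rcases le_or_gt 0 z with hz | hz
    · exact Or.inl ⟨hz, h, arcLength_of_nonneg (by omega) (by omega)⟩
    · exact Or.inr (Or.inl ⟨hz, by rw [arcLength_of_nonpos (by omega) (by omega)]; ring⟩)
  · exact Or.inr (Or.inr ⟨h, by
      rw [← arcLength_sub_mul _ _ 1, arcLength_of_nonpos (by omega) (by omega)]; omega⟩)
  · omega

/-- The distances from three consecutive vertices of an even cycle to the origin. -/
lemma arcLength_two_mul_cases {h : ℕ} (hh : 1 ≤ h) {z : ℤ} (h₁ : -h < z) (h₂ : z ≤ h) :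
    ∃ t s w : ℤ, (arcLength (2 * h) z : ℤ) = t ∧ (arcLength (2 * h) (z + 1) : ℤ) = s ∧
      (arcLength (2 * h) (z - 1) : ℤ) = w ∧
      ((s = t + 1 ∧ z = t ∧ 0 ≤ t ∧ t < h ∧ (w = t - 1 ∧ 1 ≤ t ∨ w = 1 ∧ t = 0)) ∨
        (s = t - 1 ∧ 1 ≤ t ∧ (z = -t ∧ t < h ∧ w = t + 1 ∨ z = t ∧ t = h ∧ w = h - 1))) := by
  have hs := arcLength_two_mul_add_one hh h₁.le h₂
  have hw := arcLength_two_mul_add_one hh (z := -z) (by omega) (by omega)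
  rw [show -z + 1 = -(z - 1) by ring, arcLength_neg] at hw
  refine ⟨_, _, _, rfl, rfl, rfl, ?_⟩
  have ht : (arcLength (2 * h) z : ℤ) = |z| := by
    rcases le_total 0 z with hz | hz
    · rw [arcLength_of_nonneg hz (by omega), abs_of_nonneg hz]
    · rw [arcLength_of_nonpos hz (by omega), abs_of_nonpos hz]
  rw [ht]
  rcases lt_or_ge z 0 with hz | hz
  · rw [abs_of_neg hz]
    have hs' : (arcLength (2 * h) (z + 1) : ℤ) = -z - 1 := by omega
    have hw' : (arcLength (2 * h) (z - 1) : ℤ) = -z + 1 := by omega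
    rw [hs', hw']
    exact Or.inr ⟨rfl, by omega, Or.inl ⟨by omega, by omega, rfl⟩⟩
  · rw [abs_of_nonneg hz]
    rcases eq_or_lt_of_le h₂ with hz' | hz'
    · have hs' : (arcLength (2 * h) (z + 1) : ℤ) = z - 1 := by omega
      have hw' : (arcLength (2 * h) (z - 1) : ℤ) = h - 1 := by omega
      rw [hs', hw']
      exact Or.inr ⟨rfl, by omega, Or.inr ⟨rfl, hz', rfl⟩⟩
    · have hs' : (arcLength (2 * h) (z + 1) : ℤ) = z + 1 := by omega
      rw [hs']
      refine Or.inl ⟨rfl, rfl, hz, hz', ?_⟩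
      rcases eq_or_lt_of_le hz with hz₀ | hz₀
      · exact Or.inr ⟨by omega, hz₀.symm⟩
      · exact Or.inl ⟨by omega, hz₀⟩

/-- Two integers represent adjacent vertices of the cycle of length `m`. -/
def CyclicAdjacent (m : ℕ) (z z' : ℤ) : Prop :=
  z' = z + 1 ∨ z' = z - 1 ∨ z' = z + 1 - m ∨ z' = z - 1 + m

-- Let `t`, `v` be the arc lengths of `x`, `y`; those of `x + 1`, `y + 1` are `t + σ`, `v + τ` with
-- signs `σ`, `τ`. The answers fix `t - v` and `t + v + σ + τ`. If `σ + τ` agrees for both vertices,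
-- so do `t` and `v`, and distinct vertices have opposite mixed signs; then the arc lengths of `x -
-- 1` and `y - 1` change by 4 in total, while `hS` and `hS'` allow only 2. If it differs, `t` and
-- `v` shift together, and the same bound leaves only unit steps across a turning point (0 or half a
-- turn) of one of the distances.
set_option maxHeartbeats 4000000 in
lemma eq_or_cyclicAdjacent {h k : ℕ} (hh : 3 ≤ h) (hk : 3 ≤ k) {x y x' y' a b : ℤ}
    (hx₁ : -h < x) (hx₂ : x ≤ h) (hy₁ : -k < y) (hy₂ : y ≤ k)
    (hx₁' : -h < x') (hx₂' : x' ≤ h) (hy₁' : -k < y') (hy₂' : y' ≤ k)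
    (hS : ((arcLength (2 * h) (x - 1) : ℤ) - a).natAbs +
      ((arcLength (2 * k) (y - 1) : ℤ) - b).natAbs ≤ 1)
    (hS' : ((arcLength (2 * h) (x' - 1) : ℤ) - a).natAbs +
      ((arcLength (2 * k) (y' - 1) : ℤ) - b).natAbs ≤ 1)
    (h₀ : arcLength (2 * h) (x + 1) + arcLength (2 * k) (y + 1) =
      arcLength (2 * h) (x' + 1) + arcLength (2 * k) (y' + 1))
    (h₁ : (arcLength (2 * h) x : ℤ) - arcLength (2 * k) y =
      arcLength (2 * h) x' - arcLength (2 * k) y') :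
    (x = x' ∧ y = y') ∨ (CyclicAdjacent (2 * h) x x' ∧ CyclicAdjacent (2 * k) y y') := by
  unfold CyclicAdjacent
  obtain ⟨t, s, w, ht, hs, hw, H⟩ := arcLength_two_mul_cases (by omega) hx₁ hx₂
  obtain ⟨v, r, u, hv, hr, hu, K⟩ := arcLength_two_mul_cases (by omega) hy₁ hy₂
  obtain ⟨t', s', w', ht', hs', hw', H'⟩ := arcLength_two_mul_cases (by omega) hx₁' hx₂'
  obtain ⟨v', r', u', hv', hr', hu', K'⟩ := arcLength_two_mul_cases (by omega) hy₁' hy₂'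
  zify at h₀
  rw [hs, hs', hr, hr'] at h₀
  rw [ht, ht', hv, hv'] at h₁
  rw [hw, hu] at hS
  rw [hw', hu'] at hS'
  have hd : (w - w').natAbs + (u - u').natAbs ≤ 2 := by omega
  clear hs hs' hr hr' ht ht' hv hv' hw hw' hu hu' hS hS' hx₁ hx₂ hx₁' hx₂' hy₁ hy₂ hy₁' hy₂'
  rcases H with ⟨rfl, rfl, H₁, H₂, ⟨rfl, H₃⟩ | ⟨rfl, rfl⟩⟩ |
    ⟨rfl, H₁, ⟨rfl, H₂, rfl⟩ | ⟨rfl, rfl, rfl⟩⟩ <;>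
  rcases H' with ⟨rfl, rfl, H₁', H₂', ⟨rfl, H₃'⟩ | ⟨rfl, rfl⟩⟩ |
    ⟨rfl, H₁', ⟨rfl, H₂', rfl⟩ | ⟨rfl, rfl, rfl⟩⟩ <;>
  rcases K with ⟨rfl, rfl, K₁, K₂, ⟨rfl, K₃⟩ | ⟨rfl, rfl⟩⟩ |
    ⟨rfl, K₁, ⟨rfl, K₂, rfl⟩ | ⟨rfl, rfl, rfl⟩⟩ <;>
  rcases K' with ⟨rfl, rfl, K₁', K₂', ⟨rfl, K₃'⟩ | ⟨rfl, rfl⟩⟩ |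
    ⟨rfl, K₁', ⟨rfl, K₂', rfl⟩ | ⟨rfl, rfl, rfl⟩⟩ <;>
  first
  | (exfalso; omega)
  | (left; constructor <;> omega)
  | (right; constructor <;> omega)

end SimpleGraph

namespace SimpleGraph

lemma arcLength_add_le (m : ℕ) [NeZero m] (z d : ℤ) :
    arcLength m (z + d) ≤ arcLength m z + d.natAbs := by
  have hm : (0 : ℤ) < m := by exact_mod_cast Nat.pos_of_ne_zero (NeZero.ne m)
  obtain ⟨r, c, hr, hr'⟩ : ∃ r c : ℤ, z = r + m * c ∧ r.natAbs = arcLength m z := by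
    have h₁ := Int.emod_add_mul_ediv z m
    have h₂ := Int.emod_add_mul_ediv (-z) m
    have h₃ := Int.emod_nonneg z hm.ne'
    have h₄ := Int.emod_nonneg (-z) hm.ne'
    rcases le_total (z % m) (-z % m) with h | h
    · exact ⟨z % m, z / m, h₁.symm, by rw [arcLength]; omega⟩
    · refine ⟨-(-z % m), -(-z / m), by rw [mul_neg]; omega, by rw [arcLength]; omega⟩
  rw [← hr', hr, ← arcLength_sub_mul m _ c, show r + m * c + d - m * c = r + d by ring]
  exact (arcLength_le_natAbs m _).trans (Int.natAbs_add_le r d)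

lemma natAbs_arcLength_sub_le (m : ℕ) [NeZero m] (z d : ℤ) :
    ((arcLength m (z + d) : ℤ) - arcLength m z).natAbs ≤ d.natAbs := by
  have h₁ := arcLength_add_le m z d
  have h₂ := arcLength_add_le m (z + d) (-d)
  rw [add_neg_cancel_right, Int.natAbs_neg] at h₂
  omega

lemma CyclicAdjacent.exists_dvd {m : ℕ} {z z' : ℤ} (h : CyclicAdjacent m z z') :
    ∃ δ : ℤ, (δ = 1 ∨ δ = -1) ∧ (m : ℤ) ∣ z' - (z + δ) := by
  rcases h with h | h | h | h
  · exact ⟨1, Or.inl rfl, 0, by omega⟩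
  · exact ⟨-1, Or.inr rfl, 0, by omega⟩
  · exact ⟨1, Or.inl rfl, -1, by omega⟩
  · exact ⟨-1, Or.inr rfl, 1, by omega⟩

variable {m n : ℕ} [NeZero m] [NeZero n]

/-- Two probes locate the Robber after he moves from one of two diagonally adjacent vertices. -/
lemma locatable_diagonal_pair (hm : 6 ≤ m) (hn : 6 ≤ n) (x y : ℤ) {δ ε : ℤ}
    (hδ : δ = 1 ∨ δ = -1) (hε : ε = 1 ∨ ε = -1) :
    (torus m n).Locatable 2 1 ((torus m n).closedNeighborSet
      {torusVertex m n x y, torusVertex m n (x + δ) (y + ε)}) := by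
  wlog h : δ = 1 generalizing x y δ ε
  · have := this (x + δ) (y + ε) (δ := -δ) (ε := -ε) (by omega) (by omega) (by omega)
    rwa [add_neg_cancel_right, add_neg_cancel_right, Set.pair_comm] at this
  subst h
  have hm3 : 3 ≤ m := by omega
  have hn3 : 3 ≤ n := by omega
  -- All candidates lie in a 4 by 4 box, and the probes are two of its corners on one side. As both
  -- cycles have length at least 6, distances in the box do not wrap around, and the answers give `i
  -- + j` and `i - j`.
  refine ⟨![torusVertex m n (x - 1) (y - ε), torusVertex m n (x - 1) (y + 2 * ε)],
    fun v _ => Or.inl (answerClass_subsingleton ?_ v)⟩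
  have hε2 : ε * ε = 1 := by rcases hε with rfl | rfl <;> rfl
  have hrep : ∀ w ∈ (torus m n).closedNeighborSet
      {torusVertex m n x y, torusVertex m n (x + 1) (y + ε)},
      ∃ i j : ℤ, -1 ≤ i ∧ i ≤ 2 ∧ -1 ≤ j ∧ j ≤ 2 ∧ w = torusVertex m n (x + i) (y + ε * j) := by
    intro w hw
    obtain ⟨dx, dy, hd, h | h⟩ := (mem_closedNeighborSet_pair hm3 hn3).mp hw
    · refine ⟨dx, ε * dy, by omega, by omega, ?_, ?_, ?_⟩
      · rcases hε with rfl | rfl <;> omega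
      · rcases hε with rfl | rfl <;> omega
      · rw [h, ← mul_assoc, hε2, one_mul]
    · refine ⟨1 + dx, 1 + ε * dy, by omega, by omega, ?_, ?_, ?_⟩
      · rcases hε with rfl | rfl <;> omega
      · rcases hε with rfl | rfl <;> omega
      · rw [h, mul_add, ← mul_assoc, hε2, one_mul, mul_one, add_assoc, add_assoc]
  have harc : ∀ c : ℤ, arcLength n (ε * c) = arcLength n c := by
    intro c
    rcases hε with rfl | rfl
    · rw [one_mul]
    · rw [neg_one_mul, arcLength_neg]
  have hdist : ∀ i j : ℤ, -1 ≤ i → i ≤ 2 → -1 ≤ j → j ≤ 2 →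
      ((torus m n).dist (torusVertex m n (x + i) (y + ε * j))
        (torusVertex m n (x - 1) (y - ε)) : ℤ) = i + j + 2 ∧
      ((torus m n).dist (torusVertex m n (x + i) (y + ε * j))
        (torusVertex m n (x - 1) (y + 2 * ε)) : ℤ) = i - j + 3 := by
    intro i j hi hi' hj hj'
    rw [torus_dist hm3 hn3, torus_dist hm3 hn3, show x + i - (x - 1) = i + 1 by ring,
      show y + ε * j - (y - ε) = ε * (j + 1) by ring,
      show y + ε * j - (y + 2 * ε) = ε * (j - 2) by ring, harc, harc]
    push_cast
    rw [arcLength_of_nonneg (z := i + 1) (by omega) (by omega),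
      arcLength_of_nonneg (z := j + 1) (by omega) (by omega),
      arcLength_of_nonpos (z := j - 2) (by omega) (by omega)]
    constructor <;> ring
  intro a ha b hb hab
  obtain ⟨i, j, hi, hi', hj, hj', rfl⟩ := hrep a ha
  obtain ⟨i', j', h₁, h₂, h₃, h₄, rfl⟩ := hrep b hb
  have d := hdist i j hi hi' hj hj'
  have d' := hdist i' j' h₁ h₂ h₃ h₄
  have h0 := hab 0
  have h1 := hab 1
  simp only [Matrix.cons_val_zero, Matrix.cons_val_one] at h0 h1
  rw [h0, h1] at d
  obtain rfl : i = i' := by omega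
  obtain rfl : j = j' := by omega
  rfl

/-- After two turns on an even torus the Robber is confined to a vertex or a diagonal pair. -/
lemma locatable_of_arcLength {h k : ℕ} (hm : m = 2 * h) (hn : n = 2 * k) (hh : 3 ≤ h) (hk : 3 ≤ k)
    (a b : ℕ) : (torus m n).Locatable 2 2 ((torus m n).closedNeighborSet
      {w | ∃ x y : ℤ, arcLength m x = a ∧ arcLength n y = b ∧ w = torusVertex m n x y}) := by
  have hm3 : 3 ≤ m := by omega
  have hn3 : 3 ≤ n := by omega
  set S : Set (Fin m × Fin n) := (torus m n).closedNeighborSet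
    {w | ∃ x y : ℤ, arcLength m x = a ∧ arcLength n y = b ∧ w = torusVertex m n x y} with hS
  -- Coordinates are measured from `(-1, -1)`, so that `x - 1`, `x` and `x + 1` are the horizontal
  -- offsets from the old probe at the origin, the new second probe and the new first probe.
  have hrep : ∀ w ∈ S, ∃ x y : ℤ, -h < x ∧ x ≤ h ∧ -k < y ∧ y ≤ k ∧
      ((arcLength m (x - 1) : ℤ) - a).natAbs + ((arcLength n (y - 1) : ℤ) - b).natAbs ≤ 1 ∧
      w = torusVertex m n (x - 1) (y - 1) := by
    rintro w ⟨v, ⟨x₀, y₀, hx₀, hy₀, rfl⟩, hw⟩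
    obtain ⟨dx, dy, hd, rfl⟩ := (torus_eq_or_adj_iff hm3 hn3).mp hw
    obtain ⟨x, y, hx₁, hx₂, hy₁, hy₂, he⟩ :=
      exists_torusVertex_eq (-(h : ℤ)) (-(k : ℤ)) (torusVertex m n (x₀ + dx) (y₀ + dy))
    obtain ⟨⟨c, hc⟩, ⟨d, hd'⟩⟩ := torusVertex_eq_iff.mp he
    refine ⟨x + 1, y + 1, by omega, by omega, by omega, by omega, ?_, by
      rw [he, add_sub_cancel_right, add_sub_cancel_right]⟩
    rw [add_sub_cancel_right, add_sub_cancel_right, show x = x₀ + dx - m * c by omega,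
      show y = y₀ + dy - n * d by omega, arcLength_sub_mul, arcLength_sub_mul, ← hx₀, ← hy₀]
    have h₁ := natAbs_arcLength_sub_le m x₀ dx
    have h₂ := natAbs_arcLength_sub_le n y₀ dy
    omega
  -- The shift by `k` replaces a vertical distance by its complement, so the second answer measures
  -- a difference of distances and the first a sum.
  let p : Fin 2 → Fin m × Fin n := ![torusVertex m n (-2) (-2), torusVertex m n (-1) (-1 + k)]
  have hclass : ∀ x y x' y' : ℤ, -h < x → x ≤ h → -k < y → y ≤ k → -h < x' → x' ≤ h → -k < y' →
      y' ≤ k → ((arcLength m (x - 1) : ℤ) - a).natAbs +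
        ((arcLength n (y - 1) : ℤ) - b).natAbs ≤ 1 →
      ((arcLength m (x' - 1) : ℤ) - a).natAbs + ((arcLength n (y' - 1) : ℤ) - b).natAbs ≤ 1 →
      (∀ i, (torus m n).dist (torusVertex m n (x - 1) (y - 1)) (p i) =
        (torus m n).dist (torusVertex m n (x' - 1) (y' - 1)) (p i)) →
      (x = x' ∧ y = y') ∨ (CyclicAdjacent m x x' ∧ CyclicAdjacent n y y') := by
    intro x y x' y' hx₁ hx₂ hy₁ hy₂ hx₁' hx₂' hy₁' hy₂' hs hs' he
    have h0 := he 0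
    have h1 := he 1
    simp only [p, Matrix.cons_val_zero, Matrix.cons_val_one, torus_dist hm3 hn3] at h0 h1
    rw [show x - 1 - -2 = x + 1 by ring, show y - 1 - -2 = y + 1 by ring,
      show x' - 1 - -2 = x' + 1 by ring, show y' - 1 - -2 = y' + 1 by ring] at h0
    rw [show x - 1 - -1 = x by ring, show y - 1 - (-1 + k) = y - k by ring,
      show x' - 1 - -1 = x' by ring, show y' - 1 - (-1 + k) = y' - k by ring] at h1
    subst hm hn
    have e := arcLength_two_mul_sub_half (h := k) (by omega) y
    have e' := arcLength_two_mul_sub_half (h := k) (by omega) y'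
    exact eq_or_cyclicAdjacent hh hk hx₁ hx₂ hy₁ hy₂ hx₁' hx₂' hy₁' hy₂' hs hs' h0 (by omega)
  refine ⟨p, fun v hv => ?_⟩
  obtain ⟨x, y, hx₁, hx₂, hy₁, hy₂, hs, rfl⟩ := hrep v hv
  by_cases hsub : ((torus m n).answerClass p S (torusVertex m n (x - 1) (y - 1))).Subsingleton
  · exact Or.inl hsub
  obtain ⟨u, hu, huv⟩ : ∃ u ∈ (torus m n).answerClass p S (torusVertex m n (x - 1) (y - 1)),
      u ≠ torusVertex m n (x - 1) (y - 1) := by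
    by_contra! hcon
    exact hsub fun a ha b hb => (hcon a ha).trans (hcon b hb).symm
  obtain ⟨x', y', hx₁', hx₂', hy₁', hy₂', hs', rfl⟩ := hrep u hu.1
  obtain ⟨rfl, rfl⟩ | ⟨hax, hay⟩ := hclass x y x' y' hx₁ hx₂ hy₁ hy₂ hx₁' hx₂' hy₁' hy₂' hs hs'
    fun i => (hu.2 i).symm
  · exact absurd rfl huv
  right
  obtain ⟨δ, hδ, hδ'⟩ := hax.exists_dvd
  obtain ⟨ε, hε, hε'⟩ := hay.exists_dvd
  refine (locatable_diagonal_pair (by omega) (by omega) (x - 1) (y - 1) hδ hε).mono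
    (closedNeighborSet_mono ?_)
  rintro w hw
  obtain ⟨x'', y'', hx₁'', hx₂'', hy₁'', hy₂'', hs'', rfl⟩ := hrep w hw.1
  obtain ⟨rfl, rfl⟩ | ⟨hax', -⟩ := hclass x y x'' y'' hx₁ hx₂ hy₁ hy₂ hx₁'' hx₂'' hy₁'' hy₂'' hs hs''
    fun i => (hw.2 i).symm
  · exact Or.inl rfl
  obtain ⟨rfl, rfl⟩ | ⟨hax'', -⟩ := hclass x' y' x'' y'' hx₁' hx₂' hy₁' hy₂' hx₁'' hx₂'' hy₁'' hy₂''
    hs' hs'' fun i => (hu.2 i).trans (hw.2 i).symm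
  · right
    rw [Set.mem_singleton_iff, torusVertex_eq_iff]
    exact ⟨by rwa [show x' - 1 - (x - 1 + δ) = x' - (x + δ) by ring],
      by rwa [show y' - 1 - (y - 1 + ε) = y' - (y + ε) by ring]⟩
  -- Three distinct candidates would have pairwise adjacent columns, but a cycle of length at least
  -- 6 has no triangle.
  · unfold CyclicAdjacent at hax hax' hax''
    omega

theorem copWins_two_torus_of_even (hm : Even m) (hn : Even n) (hm6 : 6 ≤ m) (hn6 : 6 ≤ n) :
    (torus m n).CopWins 2 := by
  obtain ⟨h, hh⟩ := hm
  obtain ⟨k, hk⟩ := hn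
  have hm3 : 3 ≤ m := by omega
  have hn3 : 3 ≤ n := by omega
  refine Locatable.copWins (t := 3) ⟨![torusVertex m n 0 0, torusVertex m n h 0],
    fun v _ => Or.inr ?_⟩
  obtain ⟨x, y, -, -, -, -, rfl⟩ := exists_torusVertex_eq 0 0 v
  refine (locatable_of_arcLength (h := h) (k := k) (by omega) (by omega) (by omega) (by omega)
    (arcLength m x) (arcLength n y)).mono (closedNeighborSet_mono ?_)
  rintro w ⟨-, hw⟩
  obtain ⟨x', y', -, -, -, -, rfl⟩ := exists_torusVertex_eq 0 0 w
  have h0 := hw 0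
  have h1 := hw 1
  simp only [Matrix.cons_val_zero, Matrix.cons_val_one, torus_dist hm3 hn3, sub_zero] at h0 h1
  rw [← two_mul] at hh
  have e : ∀ z : ℤ, (arcLength m (z - h) : ℤ) = h - arcLength m z := by
    intro z
    rw [hh]
    exact arcLength_two_mul_sub_half (by omega) z
  have e₁ := e x
  have e₂ := e x'
  exact ⟨x', y', by omega, by omega, rfl⟩

end SimpleGraph

/-! ### Three cops on even tori -/

namespace SimpleGraph

/-- One distance determines a vertex up to reflection. The distance to an adjacent vertex is larger
or smaller by one, which tells the two reflections apart. -/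
lemma dvd_sub_of_arcLength_eq {h : ℕ} (hh : 2 ≤ h) {z z' : ℤ}
    (h₀ : arcLength (2 * h) z = arcLength (2 * h) z')
    (h₁ : arcLength (2 * h) (z - 1) = arcLength (2 * h) (z' - 1)) :
    ((2 * h : ℕ) : ℤ) ∣ z - z' := by
  obtain ⟨r, c, rfl, hr₁, hr₂⟩ := exists_eq_add_mul_of_even (by omega : 1 ≤ h) z
  obtain ⟨r', c', rfl, hr₁', hr₂'⟩ := exists_eq_add_mul_of_even (by omega : 1 ≤ h) z'
  rw [← arcLength_sub_mul _ _ c, ← arcLength_sub_mul _ (r' + _) c', add_sub_cancel_right,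
    add_sub_cancel_right] at h₀
  rw [← arcLength_sub_mul _ _ c, ← arcLength_sub_mul _ (r' + _ - 1) c',
    show r + (2 * h : ℕ) * c - 1 - (2 * h : ℕ) * c = r - 1 by ring,
    show r' + (2 * h : ℕ) * c' - 1 - (2 * h : ℕ) * c' = r' - 1 by ring] at h₁
  obtain ⟨t, s, w, ht, -, hw, H⟩ := arcLength_two_mul_cases (by omega) hr₁ hr₂
  obtain ⟨t', s', w', ht', -, hw', H'⟩ := arcLength_two_mul_cases (by omega) hr₁' hr₂'
  obtain rfl : t = t' := by omega
  obtain rfl : w = w' := by omega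
  obtain rfl : r = r' := by omega
  exact ⟨c - c', by ring⟩

lemma exists_arcLength_two_mul_add_one {h : ℕ} (hh : 1 ≤ h) (z : ℤ) :
    ∃ b : Bool, (arcLength (2 * h) (z + 1) : ℤ) = arcLength (2 * h) z + cond b 1 (-1) := by
  obtain ⟨r, c, rfl, hr₁, hr₂⟩ := exists_eq_add_mul_of_even hh z
  rw [← arcLength_sub_mul _ (_ + 1) c, ← arcLength_sub_mul _ (r + _) c,
    show r + (2 * h : ℕ) * c + 1 - (2 * h : ℕ) * c = r + 1 by ring, add_sub_cancel_right]
  obtain ⟨t, s, w, ht, hs, -, H⟩ := arcLength_two_mul_cases hh hr₁ hr₂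
  rw [ht, hs]
  rcases H with ⟨h, -⟩ | ⟨h, -⟩
  exacts [⟨true, h⟩, ⟨false, h⟩]

variable {m n : ℕ} [NeZero m] [NeZero n]

/-- Three cops first find the column of the Robber and then his vertex. -/
theorem copWins_three_torus_of_even (hm : Even m) (hn : Even n) (hm4 : 4 ≤ m) (hn4 : 4 ≤ n) :
    (torus m n).CopWins 3 := by
  obtain ⟨h, hh⟩ := hm
  obtain ⟨k, hk⟩ := hn
  rw [← two_mul] at hh hk
  have hm3 : 3 ≤ m := by omega
  have hn3 : 3 ≤ n := by omega
  have e : ∀ z : ℤ, (arcLength m (z - h) : ℤ) = h - arcLength m z := by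
    intro z
    rw [hh]
    exact arcLength_two_mul_sub_half (by omega) z
  refine Locatable.copWins (t := 2)
    ⟨![torusVertex m n 0 0, torusVertex m n h 0, torusVertex m n 1 0], fun v _ => Or.inr ?_⟩
  obtain ⟨x, y, -, -, -, -, rfl⟩ := exists_torusVertex_eq 0 0 v
  have hsub : (torus m n).answerClass
      ![torusVertex m n 0 0, torusVertex m n h 0, torusVertex m n 1 0] Set.univ
      (torusVertex m n x y) ⊆ {w | ∃ y', w = torusVertex m n x y'} := by
    rintro w ⟨-, hw⟩
    obtain ⟨x', y', -, -, -, -, rfl⟩ := exists_torusVertex_eq 0 0 w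
    have h0 := hw 0
    have h1 := hw 1
    have h2 := hw 2
    simp only [Matrix.cons_val, torus_dist hm3 hn3, sub_zero] at h0 h1 h2
    have e₁ := e x
    have e₂ := e x'
    refine ⟨y', torusVertex_eq_iff.mpr ⟨?_, by simp⟩⟩
    subst hh
    exact dvd_sub_of_arcLength_eq (by omega) (by omega) (by omega)
  -- Only columns `x - 1`, `x`, `x + 1` remain. The first two probes give the column and the
  -- distance to row 1; the third then gives the distance to the adjacent row 0.
  refine Locatable.mono (closedNeighborSet_mono hsub) ⟨![torusVertex m n (x - 1) 1,
    torusVertex m n (x - 1 + h) 1, torusVertex m n x 0],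
    fun v _ => Or.inl (answerClass_subsingleton ?_ v)⟩
  have hrep : ∀ w ∈ (torus m n).closedNeighborSet {w | ∃ y', w = torusVertex m n x y'},
      ∃ i y' : ℤ, 0 ≤ i ∧ i ≤ 2 ∧ w = torusVertex m n (x - 1 + i) y' := by
    rintro w ⟨v, ⟨y', rfl⟩, hw⟩
    obtain ⟨dx, dy, hd, rfl⟩ := (torus_eq_or_adj_iff hm3 hn3).mp hw
    exact ⟨dx + 1, y' + dy, by omega, by omega, by rw [show x - 1 + (dx + 1) = x + dx by ring]⟩
  intro a ha b hb hab
  obtain ⟨i, y, hi, hi', rfl⟩ := hrep a ha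
  obtain ⟨j, y', hj, hj', rfl⟩ := hrep b hb
  have h0 := hab 0
  have h1 := hab 1
  have h2 := hab 2
  simp only [Matrix.cons_val, torus_dist hm3 hn3, sub_zero, add_sub_cancel_left,
    add_sub_add_left_eq_sub] at h0 h1 h2
  have ei := e i
  have ej := e j
  rw [arcLength_of_nonneg hi (by omega)] at ei
  rw [arcLength_of_nonneg hj (by omega)] at ej
  have fi := arcLength_of_nonneg (n := m) hi (by omega)
  have fj := arcLength_of_nonneg (n := m) hj (by omega)
  obtain rfl : i = j := by omega
  refine torusVertex_eq_iff.mpr ⟨by simp, ?_⟩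
  subst hk
  exact dvd_sub_of_arcLength_eq (by omega) (by omega) (by omega)

/-! ### Evading two cops on an even cycle times a 4-cycle -/

/-- The change of the distance to a probe along four consecutive vertices of an even cycle, starting
at offset `-1` and normalized at offset `0`. -/
def horizontalChange (b : Bool × Bool × Bool) (i : ℤ) : ℤ :=
  if i = -1 then -cond b.1 1 (-1) else if i = 1 then cond b.2.1 1 (-1)
  else if i = 2 then cond b.2.1 1 (-1) + cond b.2.2 1 (-1) else 0

/-- The normalized distance in a torus of height four from a vertex with given offset. -/
def normalizedDist (b : Bool × Bool × Bool) (c : Fin 4) (q : ℤ × ℤ) : ℤ :=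
  horizontalChange b q.1 + arcLength 4 (c + q.2)

lemma exists_horizontalChange {h : ℕ} (hh : 1 ≤ h) (z : ℤ) : ∃ b : Bool × Bool × Bool,
    ∀ i : ℤ, -1 ≤ i → i ≤ 2 →
      (arcLength (2 * h) (z + i) : ℤ) = arcLength (2 * h) z + horizontalChange b i := by
  obtain ⟨b₀, h₀⟩ := exists_arcLength_two_mul_add_one hh (z - 1)
  obtain ⟨b₁, h₁⟩ := exists_arcLength_two_mul_add_one hh z
  obtain ⟨b₂, h₂⟩ := exists_arcLength_two_mul_add_one hh (z + 1)
  rw [sub_add_cancel] at h₀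
  refine ⟨(b₀, b₁, b₂), fun i hi hi' => ?_⟩
  obtain rfl | rfl | rfl | rfl : i = -1 ∨ i = 0 ∨ i = 1 ∨ i = 2 := by omega
  · rw [← sub_eq_add_neg, h₀]; simp [horizontalChange]
  · simp [horizontalChange]
  · rw [h₁]; simp [horizontalChange]
  · rw [show z + 2 = z + 1 + 1 by ring, h₂, h₁]; simp [horizontalChange, add_assoc]

lemma exists_fin_four (z : ℤ) : ∃ c : Fin 4, ∀ j : ℤ, arcLength 4 (z + j) = arcLength 4 (c + j) := by
  refine ⟨⟨(z % 4).toNat, by omega⟩, fun j => ?_⟩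
  rw [← arcLength_sub_mul 4 (z + j) (z / 4)]
  congr 1
  have := Int.emod_add_mul_ediv z 4
  simp only [Nat.cast_ofNat]
  omega

/-- Offsets of the evasive pairs in the neighbourhood of a vertical pair. -/
def verticalOffsets : List ((ℤ × ℤ) × (ℤ × ℤ)) :=
  [((-1, 0), (-1, 2)), ((0, 0), (0, 2)), ((1, 0), (1, 2)), ((0, 1), (0, 3)),
    ((-1, 0), (0, 1)), ((-1, 0), (0, -1)), ((-1, 2), (0, 1)), ((-1, 2), (0, 3)),
    ((0, 1), (1, 0)), ((0, -1), (1, 0)), ((0, 1), (1, 2)), ((0, 3), (1, 2))]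

/-- Offsets of the evasive pairs in the neighbourhood of a diagonal pair. -/
def diagonalOffsets : List ((ℤ × ℤ) × (ℤ × ℤ)) :=
  [((0, -1), (0, 1)), ((1, 0), (1, 2)), ((0, 0), (1, 1)), ((0, 1), (1, 0)), ((0, 1), (1, 2)),
    ((0, -1), (1, 0)), ((-1, 0), (0, 1)), ((-1, 0), (0, -1)), ((1, 0), (2, 1)), ((1, 2), (2, 1))]

/-- The check covers all sign patterns, including those that no probe produces, and is therefore
independent of `m`. -/
lemma exists_verticalOffsets : ∀ (b b' : Bool × Bool × Bool) (c c' : Fin 4),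
    ∃ q ∈ verticalOffsets, normalizedDist b c q.1 = normalizedDist b c q.2 ∧
      normalizedDist b' c' q.1 = normalizedDist b' c' q.2 := by
  decide +kernel

lemma exists_diagonalOffsets : ∀ (b b' : Bool × Bool × Bool) (c c' : Fin 4),
    ∃ q ∈ diagonalOffsets, normalizedDist b c q.1 = normalizedDist b c q.2 ∧
      normalizedDist b' c' q.1 = normalizedDist b' c' q.2 := by
  decide +kernel

end SimpleGraph

namespace SimpleGraph

/-- An evasive pair consists of two vertices that are antipodal in the same cycle of length four,
or diagonally adjacent. -/
def IsEvasivePair (m : ℕ) [NeZero m] (u w : Fin m × Fin 4) : Prop :=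
  ∃ x y ε : ℤ, (ε = 1 ∨ ε = -1) ∧ u = torusVertex m 4 x y ∧
    (w = torusVertex m 4 x (y + 2 * ε) ∨ w = torusVertex m 4 (x + 1) (y + ε))

/-- Rows are not reduced modulo 4: `-1` and `3` name the same row, and both occur so that the shape
of each pair and the distance to the old pair can be read off in the integers. -/
lemma verticalOffsets_spec : ∀ q ∈ verticalOffsets,
    (-1 ≤ q.1.1 ∧ q.1.1 ≤ 2 ∧ -1 ≤ q.2.1 ∧ q.2.1 ≤ 2) ∧
    (q.2 = (q.1.1, q.1.2 + 2) ∨ q.2 = (q.1.1 + 1, q.1.2 + 1) ∨ q.2 = (q.1.1 + 1, q.1.2 - 1)) ∧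
    (q.1.1.natAbs + q.1.2.natAbs ≤ 1 ∨ q.1.1.natAbs + (q.1.2 - 2).natAbs ≤ 1) ∧
    (q.2.1.natAbs + q.2.2.natAbs ≤ 1 ∨ q.2.1.natAbs + (q.2.2 - 2).natAbs ≤ 1) := by
  decide +kernel

lemma diagonalOffsets_spec : ∀ q ∈ diagonalOffsets,
    (-1 ≤ q.1.1 ∧ q.1.1 ≤ 2 ∧ -1 ≤ q.2.1 ∧ q.2.1 ≤ 2) ∧
    (q.2 = (q.1.1, q.1.2 + 2) ∨ q.2 = (q.1.1 + 1, q.1.2 + 1) ∨ q.2 = (q.1.1 + 1, q.1.2 - 1)) ∧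
    (q.1.1.natAbs + q.1.2.natAbs ≤ 1 ∨ (q.1.1 - 1).natAbs + (q.1.2 - 1).natAbs ≤ 1) ∧
    (q.2.1.natAbs + q.2.2.natAbs ≤ 1 ∨ (q.2.1 - 1).natAbs + (q.2.2 - 1).natAbs ≤ 1) := by
  decide +kernel

/-- On an even cycle times the cycle of length four, the Robber evades two cops by keeping two
vertices at vertical distance two or diagonally adjacent vertices possible. -/
theorem not_copWins_two_torus_four {m : ℕ} [NeZero m] (hm : Even m) (hm4 : 4 ≤ m) :
    ¬ (torus m 4).CopWins 2 := by
  obtain ⟨h, hh⟩ := hm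
  rw [← two_mul] at hh
  have hm3 : 3 ≤ m := by omega
  refine not_copWins_of_pairs (IsEvasivePair m) ?_
    ⟨_, _, 0, 0, 1, Or.inl rfl, rfl, Or.inl rfl⟩ ?_
  · rintro u w ⟨x, y, ε, hε, rfl, rfl | rfl⟩ he
    · have := (torusVertex_eq_iff.mp he).2
      rcases hε with rfl | rfl <;> omega
    · obtain ⟨c, hc⟩ := (torusVertex_eq_iff.mp he).1
      have hu : (m : ℤ) ∣ 1 := ⟨-c, by rw [mul_neg]; omega⟩
      have := Int.le_of_dvd one_pos hu
      omega
  · rintro u w ⟨x, y, ε, hε, rfl, hw⟩ p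
    have hε2 : ε * ε = 1 := by rcases hε with rfl | rfl <;> rfl
    have harc : ∀ c : ℤ, arcLength 4 (ε * c) = arcLength 4 c := by
      intro c
      rcases hε with rfl | rfl
      · rw [one_mul]
      · rw [neg_one_mul, arcLength_neg]
    have habs : ∀ c : ℤ, (ε * c).natAbs = c.natAbs := by
      intro c
      rcases hε with rfl | rfl <;> simp
    -- The factor `ε` reflects the rows so that one list of offsets serves both signs. The constant
    -- `D` cancels when two answers are compared.
    have hprobe : ∀ v : Fin m × Fin 4, ∃ (b : Bool × Bool × Bool) (c : Fin 4) (D : ℤ),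
        ∀ q : ℤ × ℤ, -1 ≤ q.1 → q.1 ≤ 2 →
          ((torus m 4).dist (torusVertex m 4 (x + q.1) (y + ε * q.2)) v : ℤ) =
            D + normalizedDist b c q := by
      intro v
      obtain ⟨a, a', -, -, -, -, rfl⟩ := exists_torusVertex_eq 0 0 v
      obtain ⟨b, hb⟩ := exists_horizontalChange (h := h) (by omega) (x - a)
      obtain ⟨c, hc⟩ := exists_fin_four (ε * (y - a'))
      refine ⟨b, c, arcLength m (x - a), fun q hq hq' => ?_⟩
      have hx := hb q.1 hq hq'
      rw [← hh] at hx
      rw [torus_dist hm3 (by norm_num), normalizedDist, ← hc, ← harc (ε * (y - a') + q.2), mul_add,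
        ← mul_assoc, hε2, one_mul, show x + q.1 - a = x - a + q.1 by ring,
        show y + ε * q.2 - a' = y - a' + ε * q.2 by ring]
      push_cast
      rw [hx]
      ring
    obtain ⟨b, c, D, hD⟩ := hprobe (p 0)
    obtain ⟨b', c', D', hD'⟩ := hprobe (p 1)
    have hmem : ∀ i j : ℤ, ∀ q : ℤ × ℤ, w = torusVertex m 4 (x + i) (y + ε * j) →
        (q.1.natAbs + q.2.natAbs ≤ 1 ∨ (q.1 - i).natAbs + (q.2 - j).natAbs ≤ 1) →
        torusVertex m 4 (x + q.1) (y + ε * q.2) ∈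
          (torus m 4).closedNeighborSet {torusVertex m 4 x y, w} := by
      rintro i j q rfl hq
      rw [mem_closedNeighborSet_pair hm3 (by norm_num)]
      rcases hq with hq | hq
      · exact ⟨q.1, ε * q.2, by rwa [habs], Or.inl rfl⟩
      · exact ⟨q.1 - i, ε * (q.2 - j), by rwa [habs], Or.inr (by ring_nf)⟩
    have hpair : ∀ q : (ℤ × ℤ) × (ℤ × ℤ), (q.2 = (q.1.1, q.1.2 + 2) ∨
        q.2 = (q.1.1 + 1, q.1.2 + 1) ∨ q.2 = (q.1.1 + 1, q.1.2 - 1)) →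
        IsEvasivePair m (torusVertex m 4 (x + q.1.1) (y + ε * q.1.2))
          (torusVertex m 4 (x + q.2.1) (y + ε * q.2.2)) := by
      rintro ⟨⟨i, j⟩, q⟩ hq
      dsimp only at hq
      rcases hq with rfl | rfl | rfl
      · exact ⟨_, _, ε, hε, rfl, Or.inl (by ring_nf)⟩
      · exact ⟨_, _, ε, hε, rfl, Or.inr (by ring_nf)⟩
      · exact ⟨_, _, -ε, by omega, rfl, Or.inr (by ring_nf)⟩
    have hdist : ∀ q : (ℤ × ℤ) × (ℤ × ℤ),
        (-1 ≤ q.1.1 ∧ q.1.1 ≤ 2 ∧ -1 ≤ q.2.1 ∧ q.2.1 ≤ 2) →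
        normalizedDist b c q.1 = normalizedDist b c q.2 →
        normalizedDist b' c' q.1 = normalizedDist b' c' q.2 →
        ∀ i, (torus m 4).dist (torusVertex m 4 (x + q.1.1) (y + ε * q.1.2)) (p i) =
          (torus m 4).dist (torusVertex m 4 (x + q.2.1) (y + ε * q.2.2)) (p i) := by
      rintro q ⟨h₁, h₂, h₃, h₄⟩ he he' i
      have k₁ := hD q.1 h₁ h₂
      have k₂ := hD q.2 h₃ h₄
      have k₁' := hD' q.1 h₁ h₂
      have k₂' := hD' q.2 h₃ h₄
      fin_cases i
      · simp only [Fin.zero_eta]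
        omega
      · simp only [Fin.mk_one]
        omega
    rcases hw with hw | hw
    · obtain ⟨q, hq, he, he'⟩ := exists_verticalOffsets b b' c c'
      obtain ⟨h₁, h₂, h₃, h₄⟩ := verticalOffsets_spec q hq
      have hw' : w = torusVertex m 4 (x + 0) (y + ε * 2) := by rw [hw, add_zero, mul_comm]
      exact ⟨_, _, hpair q h₂, hmem 0 2 q.1 hw' (by rwa [sub_zero]),
        hmem 0 2 q.2 hw' (by rwa [sub_zero]), hdist q h₁ he he'⟩
    · obtain ⟨q, hq, he, he'⟩ := exists_diagonalOffsets b b' c c'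
      obtain ⟨h₁, h₂, h₃, h₄⟩ := diagonalOffsets_spec q hq
      have hw' : w = torusVertex m 4 (x + 1) (y + ε * 1) := by rw [hw, mul_one]
      exact ⟨_, _, hpair q h₂, hmem 1 1 q.1 hw' h₃, hmem 1 1 q.2 hw' h₄, hdist q h₁ he he'⟩

/-! ### The torus of two triangles -/

/-- The distance in the torus with two cycles of length three. -/
def distThree (u v : Fin 3 × Fin 3) : ℕ :=
  (if u.1 = v.1 then 0 else 1) + if u.2 = v.2 then 0 else 1

lemma torus_three_dist (u v : Fin 3 × Fin 3) : (torus 3 3).dist u v = distThree u v := by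
  rw [← Nat.cast_inj (R := ℕ∞), (torus_connected _ _).coe_dist_eq_edist, edist_boxProd,
    cycleGraph_three_eq_top, edist_top, edist_top, distThree]
  split_ifs <;> rfl

theorem copWins_three_torus_three : (torus 3 3).CopWins 3 := by
  have hres : ∀ u v : Fin 3 × Fin 3, distThree u (0, 0) = distThree v (0, 0) →
      distThree u (0, 1) = distThree v (0, 1) → distThree u (1, 0) = distThree v (1, 0) →
      u = v := by
    decide +kernel
  refine Locatable.copWins (t := 1)
    ⟨![(0, 0), (0, 1), (1, 0)], fun v _ => Or.inl (answerClass_subsingleton ?_ v)⟩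
  intro a _ b _ hab
  simp only [torus_three_dist] at hab
  exact hres a b (hab 0) (hab 1) (hab 2)

lemma exists_pair_distThree : ∀ u w : Fin 3 × Fin 3, u ≠ w → ∀ p q : Fin 3 × Fin 3,
    ∃ u' w' : Fin 3 × Fin 3, (distThree u u' ≤ 1 ∨ distThree w u' ≤ 1) ∧ u' ≠ w' ∧
      distThree u' p = distThree w' p ∧ distThree u' q = distThree w' q ∧
      (distThree u w' ≤ 1 ∨ distThree w w' ≤ 1) := by
  decide +kernel

theorem not_copWins_two_torus_three : ¬ (torus 3 3).CopWins 2 := by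
  refine not_copWins_of_pairs (fun u w => u ≠ w) (fun _ _ h => h) ⟨(0, 0), (0, 1), by decide⟩ ?_
  intro u w huw p
  obtain ⟨u', w', hu, hne, h₀, h₁, hw⟩ := exists_pair_distThree u w huw (p 0) (p 1)
  have hball : ∀ a v : Fin 3 × Fin 3, distThree a v ≤ 1 → v = a ∨ (torus 3 3).Adj a v := by
    intro a v h
    rw [← torus_three_dist] at h
    rcases Nat.le_one_iff_eq_zero_or_eq_one.mp h with h | h
    · exact Or.inl ((torus_connected.dist_eq_zero_iff).mp h).symm
    · exact Or.inr (dist_eq_one_iff_adj.mp h)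
  have hmem : ∀ v, distThree u v ≤ 1 ∨ distThree w v ≤ 1 →
      v ∈ (torus 3 3).closedNeighborSet {u, w} := by
    rintro v (h | h)
    exacts [⟨u, by simp, hball u v h⟩, ⟨w, by simp, hball w v h⟩]
  refine ⟨u', w', hne, hmem u' hu, hmem w' hw, fun i => ?_⟩
  simp only [torus_three_dist]
  fin_cases i
  exacts [h₀, h₁]

/-! ### Assembling the cases -/

/-- The localization number of the Cartesian product of two cycles. -/
theorem localizationNumber_torus (m n : ℕ) (hn : 3 ≤ n) (hmn : n ≤ m) :
    (((m = 3 ∧ n = 3) ∨ (Even m ∧ n = 4)) → (torus m n).localizationNumber = 3) ∧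
    (¬ ((m = 3 ∧ n = 3) ∨ (Even m ∧ n = 4)) → (torus m n).localizationNumber = 2) := by
  have hm : 3 ≤ m := hn.trans hmn
  have : NeZero m := ⟨by omega⟩
  have : NeZero n := ⟨by omega⟩
  have h1 : ¬ (torus m n).CopWins 1 := not_copWins_one_torus hm hn
  constructor
  · intro h
    have h2 : ¬ (torus m n).CopWins 2 := by
      rcases h with ⟨rfl, rfl⟩ | ⟨he, rfl⟩
      exacts [not_copWins_two_torus_three, not_copWins_two_torus_four he hmn]
    have h3 : (torus m n).CopWins 3 := by
      rcases h with ⟨rfl, rfl⟩ | ⟨he, rfl⟩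
      exacts [copWins_three_torus_three, copWins_three_torus_of_even he (by decide) hmn le_rfl]
    refine IsLeast.csInf_eq ⟨⟨by norm_num, h3⟩, ?_⟩
    rintro k ⟨hk, hwin⟩
    by_contra! hlt
    obtain rfl | rfl : k = 1 ∨ k = 2 := by omega
    exacts [h1 hwin, h2 hwin]
  · intro h
    have h2 : (torus m n).CopWins 2 := by
      rcases Nat.even_or_odd n with hne | hno
      · rcases Nat.even_or_odd m with hme | hmo
        · have hn4 : n ≠ 4 := fun h4 => h (Or.inr ⟨hme, h4⟩)
          obtain ⟨l, hl⟩ := id hne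
          exact copWins_two_torus_of_even hme hne (by omega) (by omega)
        · obtain ⟨l, hl⟩ := id hne
          exact copWins_two_torus_of_odd hmo hm (by omega)
      · have hm4 : 4 ≤ m := by
          by_contra hlt
          exact h (Or.inl ⟨by omega, by omega⟩)
        -- The odd cycle must be the first factor, so the factors are swapped; excluding `m = n = 3`
        -- guarantees that the other one has length at least 4.
        exact (copWins_two_torus_of_odd hno hn hm4).of_iso (boxProdComm _ _)
    refine IsLeast.csInf_eq ⟨⟨by norm_num, h2⟩, ?_⟩
    rintro k ⟨hk, hwin⟩
    by_contra! hlt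
    obtain rfl : k = 1 := by omega
    exact h1 hwin

end SimpleGraph

theorem theorem5p2 (m n : ℕ) (hn : 3 ≤ n) (hmn : n ≤ m) :
    (((m = 3 ∧ n = 3) ∨ (Even m ∧ n = 4)) →
      (SimpleGraph.boxProd (SimpleGraph.cycleGraph m)
        (SimpleGraph.cycleGraph n)).localizationNumber = 3) ∧
    (¬ ((m = 3 ∧ n = 3) ∨ (Even m ∧ n = 4)) →
      (SimpleGraph.boxProd (SimpleGraph.cycleGraph m)
        (SimpleGraph.cycleGraph n)).localizationNumber = 2) :=
  SimpleGraph.localizationNumber_torus m n hn hmn
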